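/- **Setting.** Let $x_1<x_2<\dots<x_{2N}$ be real numbers, let $D=\bigcup_{i=1}^N(x_{2i-1},x_{2i})$, and let the wave speeds inside and outside $D$ be equal ($r=1$). Put $t_j=x_{j+1}-x_j$ for $1\le j\le 2N-1$. For $k,\delta\in\mathbb C$, an *eigenmode* at $(k,\delta)$ is a continuous function $u:\mathbb R\to\mathbb C$, not identically zero, with $$u''+k^2u=0 \text{ on } D \text{ and on } \mathbb R\setminus\overline D,\qquad u'|_+(x_{2j-1})=\delta\,u'|_-(x_{2j-1}),\quad u'|_-(x_{2j})=\delta\,u'|_+(x_{2j})\quad(1\le j\le N),$$ and $\big(\tfrac{d}{d|x|}-\mathrm ik\big)u=0$ on $(-\infty,x_1)\cup(x_{2N},\infty)$ (that is, $-u'=\mathrm iku$ on the left and $u'=\mathrm iku$ on the right); $k$ is a *resonance* for $\delta$ if an eigenmode exists. For $k_0\in\mathbb R$ let $I=\{1\le j\le 2N-1: t_jk_0\in\pi\mathbb Z\}$, put $1/t_j(k_0)=1/t_j$ if $j\in I$ and $1/t_j(k_0)=0$ otherwise, and let $\theta_j(k_0)=\frac1{t_j(k_0)}\cdot\frac1{t_{j+1}(k_0)}$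 for $1\le j\le 2N-2$, $\theta_0(k_0)=\theta_{2N-1}(k_0)=0$. Let $\mathcal C(k_0)$ be the $N\times N$ tridiagonal matrix whose $i$-th row has diagonal entry $\theta_{2i-2}(k_0)+\theta_{2i-1}(k_0)$, entry $-\theta_{2i-2}(k_0)$ to its left and $-\theta_{2i-1}(k_0)$ to its right. Write $I$ as the disjoint union of its maximal integer intervals $\mathcal I_j=\{a_j,\dots,b_j\}$. For each $j$, let $C_j$ be the principal submatrix of $\mathcal C(k_0)$ with indices from $\lfloor a_j/2\rfloor+1$ to $\lceil b_j/2\rceil$, and let $D_j=\mathcal S^{-1}A\mathcal L^{-1}A^\top$, where $\mathcal S$ and $\mathcal L$ are the diagonal matrices of the $t_i$ with $i\in\mathcal I_j$ even, respectively odd (in increasing order), and $A$ has rows indexed by the even $i\in\mathcal I_j$, columns indexed by the odd $i'\in\mathcal I_j$, and entries $A_{i,i'}=-1$ if $i'=i-1$, $A_{i,i'}=1$ if $i'=i+1$, and $0$ otherwise. **Theorem.** Let $k_0\in\mathbb R$, $k_0\ne0$, and let $\lambda\neq0$ be an eigenvalue of $\mathcal C(k_0)$ of algebraic multiplicity one.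 Then there is a unique $j_*$ such that $\lambda$ is an eigenvalue of $C_{j_*}$, and it is a simple eigenvalue of $C_{j_*}$. Write $\mathcal I_{j_*}=\{a,\dots,b\}$ and let $\mathcal E$ be the set of even integers in $\mathcal I_{j_*}$. There are a real eigenvector $\boldsymbol\beta=(\beta_i)_{i\in\mathcal E}\ne0$ of $D_{j_*}$ for the eigenvalue $\lambda$ and positive integers $\gamma_i$ such that the following holds. If, as $\delta\to0$ in $\mathbb C\setminus\{0\}$, $k(\delta)=k_0\pm\sqrt{\lambda\delta}+\mathcal O(\delta)$ is a resonance for $\delta$, and $u=u_\delta$ is an associated eigenmode, then, after multiplication of $u$ by a suitable nonzero constant (which may depend on $\delta$), $$u(x)=\beta_i\,\sin\bigl(k_0(x-x_a)\bigr)+\mathcal O(\delta^{1/2})\quad\text{for }x\in(x_i,x_{i+1}),\ i\in\mathcal E,$$ $$u(x)=\mathcal O(\delta^{\gamma_i/2})\quad\text{for }x\in(x_i,x_{i+1}),\ 1\le i\le 2N-1,\ i\notin\mathcal E.$$ Here the bounds are uniform in $x$, and they are uniform in the resonance: for every $M$ there are $\delta_0>0$ and $K$ such that for all $\delta\in\mathbb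 C$ with $0<|\delta|<\delta_0$, both square roots $\kappa$ of $\lambda\delta$, all resonances $k$ with $|k-k_0-\kappa|\le M|\delta|$ and all eigenmodes $u$ at $(k,\delta)$, the two estimates hold, after normalization of $u$, with errors at most $K|\delta|^{1/2}$ and $K|\delta|^{\gamma_i/2}$. -/

import Mathlib

open Filter Topology

noncomputable section

namespace ResonatorChain

/-! A chain of `N` resonators `(x₁, x₂), (x₃, x₄), …, (x₂ₙ₋₁, x₂ₙ)` on the line. The end points are
given by a sequence `x : ℕ → ℝ` of which only the terms `x 1, …, x (2 * N)` matter, so that the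
indices are the usual one-based ones. The ratio of the wave speeds outside and inside the
resonators is `r`. -/

/-- The union of the open resonators. -/
def resonators (N : ℕ) (x : ℕ → ℝ) : Set ℝ :=
  ⋃ i ∈ Set.Icc 1 N, Set.Ioo (x (2 * i - 1)) (x (2 * i))

/-- `u` is an eigenmode (a nontrivial solution of the scattering problem) for the contrast `δ` and
the wave number `k = ω / v` of the background. -/
structure IsEigenmode (N : ℕ) (x : ℕ → ℝ) (r : ℝ) (δ k : ℂ) (u : ℝ → ℂ) : Prop where
  nontrivial : ∃ y, u y ≠ 0
  continuous : Continuous u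
  helmholtz_outside : ∀ y ∉ closure (resonators N x),
    DifferentiableAt ℝ u y ∧ DifferentiableAt ℝ (deriv u) y ∧
      deriv (deriv u) y + k ^ 2 * u y = 0
  helmholtz_inside : ∀ y ∈ resonators N x,
    DifferentiableAt ℝ u y ∧ DifferentiableAt ℝ (deriv u) y ∧
      deriv (deriv u) y + ((r : ℂ) * k) ^ 2 * u y = 0
  /-- At the left end of a resonator, `u'₊ = δ u'₋`. -/
  jump_left : ∀ j ∈ Set.Icc 1 N, ∃ d : ℂ,
    Tendsto (deriv u) (𝓝[<] (x (2 * j - 1))) (𝓝 d) ∧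
      Tendsto (deriv u) (𝓝[>] (x (2 * j - 1))) (𝓝 (δ * d))
  /-- At the right end of a resonator, `u'₋ = δ u'₊`. -/
  jump_right : ∀ j ∈ Set.Icc 1 N, ∃ d : ℂ,
    Tendsto (deriv u) (𝓝[>] (x (2 * j))) (𝓝 d) ∧
      Tendsto (deriv u) (𝓝[<] (x (2 * j))) (𝓝 (δ * d))
  radiation_left : ∀ y < x 1, -deriv u y - Complex.I * k * u y = 0
  radiation_right : ∀ y > x (2 * N), deriv u y - Complex.I * k * u y = 0

/-- The vector `t = (r ℓ₁, s₁, r ℓ₂, s₂, …, r ℓₙ)`: odd indices belong to resonators, even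
indices to spacings. -/
def t (x : ℕ → ℝ) (r : ℝ) (j : ℕ) : ℝ :=
  if Even j then x (j + 1) - x j else r * (x (j + 1) - x j)

/-- `j` belongs to the resonant index set `I(k)`. -/
def IsResonantIndex (N : ℕ) (x : ℕ → ℝ) (r k : ℝ) (j : ℕ) : Prop :=
  1 ≤ j ∧ j ≤ 2 * N - 1 ∧ ∃ m : ℤ, t x r j * k = m * Real.pi

open Classical in
/-- The number `1 / t_j(k)`, which is `0 = 1 / ∞` unless `j` is a resonant index. -/
def invT (N : ℕ) (x : ℕ → ℝ) (r k : ℝ) (j : ℕ) : ℝ :=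
  if IsResonantIndex N x r k j then 1 / t x r j else 0

/-- The coupling coefficient `θ_j(k)`; it vanishes for `j = 0` and for `j = 2 * N - 1`. -/
def theta (N : ℕ) (x : ℕ → ℝ) (r k : ℝ) (j : ℕ) : ℝ :=
  invT N x r k j * invT N x r k (j + 1)

/-- The frequency-dependent capacitance matrix. The row `i : Fin N` is the `(i + 1)`-st row, with
entries `-θ_{2i}, θ_{2i} + θ_{2i+1}, -θ_{2i+1}` around the diagonal. -/
def capacitance (N : ℕ) (x : ℕ → ℝ) (r k : ℝ) : Matrix (Fin N) (Fin N) ℝ := fun i j =>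
  if (i : ℕ) = j then theta N x r k (2 * i) + theta N x r k (2 * i + 1)
  else if (j : ℕ) + 1 = i then -theta N x r k (2 * i)
  else if (i : ℕ) + 1 = j then -theta N x r k (2 * i + 1)
  else 0

/-- `{a, a + 1, …, b}` is one of the maximal integer intervals that make up `I(k)`. -/
def IsResonantBlock (N : ℕ) (x : ℕ → ℝ) (r k : ℝ) (a b : ℕ) : Prop :=
  1 ≤ a ∧ a ≤ b ∧ (∀ j, a ≤ j → j ≤ b → IsResonantIndex N x r k j) ∧
    ¬ IsResonantIndex N x r k (a - 1) ∧ ¬ IsResonantIndex N x r k (b + 1)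

/-- The principal submatrix of the capacitance matrix that belongs to the interval `{a, …, b}`: its
one-based row and column indices run from `⌊a / 2⌋ + 1` to `⌈b / 2⌉`. -/
def blockC (N : ℕ) (x : ℕ → ℝ) (r k : ℝ) (a b : ℕ) :
    Matrix {i : Fin N // a / 2 + 1 ≤ (i : ℕ) + 1 ∧ (i : ℕ) + 1 ≤ (b + 1) / 2}
      {i : Fin N // a / 2 + 1 ≤ (i : ℕ) + 1 ∧ (i : ℕ) + 1 ≤ (b + 1) / 2} ℝ :=
  (capacitance N x r k).submatrix Subtype.val Subtype.val

/-- The number of even integers in `{a, …, b}`. -/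
def numEven (a b : ℕ) : ℕ := b / 2 - (a - 1) / 2

/-- The number of odd integers in `{a, …, b}`. -/
def numOdd (a b : ℕ) : ℕ := (b + 1) / 2 - a / 2

/-- The even integers `2⌈a / 2⌉, 2⌈a / 2⌉ + 2, …` of `{a, …, b}`, numbered from `0`. -/
def evenIndex (a j : ℕ) : ℕ := 2 * ((a + 1) / 2) + 2 * j

/-- The odd integers `2⌊a / 2⌋ + 1, 2⌊a / 2⌋ + 3, …` of `{a, …, b}`, numbered from `0`. -/
def oddIndex (a j : ℕ) : ℕ := 2 * (a / 2) + 1 + 2 * j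

/-- The difference matrix: in one-based indices `A_{i, i - 1 + ξ} = -1` and `A_{i, i + ξ} = 1`,
where `ξ` is the parity of `a`, and all other entries are zero. -/
def diffMatrix (a b : ℕ) : Matrix (Fin (numEven a b)) (Fin (numOdd a b)) ℝ := fun i j =>
  if (j : ℕ) + 1 = i + a % 2 then -1
  else if (j : ℕ) = i + a % 2 then 1
  else 0

/-- The diagonal matrix of the `t_j` with `j` even in `{a, …, b}`. -/
def diagEven (x : ℕ → ℝ) (r : ℝ) (a b : ℕ) :
    Matrix (Fin (numEven a b)) (Fin (numEven a b)) ℝ :=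
  Matrix.diagonal fun i => t x r (evenIndex a i)

/-- The diagonal matrix of the `t_j` with `j` odd in `{a, …, b}`. -/
def diagOdd (x : ℕ → ℝ) (r : ℝ) (a b : ℕ) :
    Matrix (Fin (numOdd a b)) (Fin (numOdd a b)) ℝ :=
  Matrix.diagonal fun i => t x r (oddIndex a i)

/-- The matrix `D = S⁻¹ A L⁻¹ Aᵀ` of the interval `{a, …, b}`. -/
def blockD (x : ℕ → ℝ) (r : ℝ) (a b : ℕ) :
    Matrix (Fin (numEven a b)) (Fin (numEven a b)) ℝ :=
  (diagEven x r a b)⁻¹ * (diffMatrix a b * (diagOdd x r a b)⁻¹ * (diffMatrix a b).transpose)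

end ResonatorChain

end

/-!
Inside every interval an eigenmode `u` is determined by its value and its derivative at the left
end, so that the scattering problem becomes a system of transfer equations for the values `u (x j)`
and the derivatives `D j` on the outer sides of the resonators (`HasOuterDerivs`). Scale `u` so
that `max |D j| = 1`; this is possible since a mode with all `D j = 0` vanishes identically. Write
`k = k₀ + κ + O(κ²)`, where `δ = κ² / lam`.

A resonator sees the derivatives `δ D j` at its ends. If it is resonant, then `sin (k t_j)` is
`± κ t_j` to leading order, and hence the values of `u` there are `O(κ)`; otherwise they are even
`O(κ²)`. A spacing that is not resonant then carries derivatives of size `O(κ)`, and so do the two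
unbounded intervals by the radiation condition. So only the resonant spacings carry a mode of
size one. After the signs `cos (k₀ t_j) = ± 1` have been removed by the `gauge`, the values at the
resonators, divided by `κ`, form a vector `w` with

* `lam * w i = (q (2 i + 1) - q (2 i + 2)) / t (2 i + 1) + O(κ)`, where `q j` is the signed `D j`,
* `q (2 i + 2) = q (2 i + 3) + O(κ) = (w (i + 1) - w i) / t (2 i + 2) + O(κ)`,

where `1 / t j` is read as zero if `j` is not resonant. Eliminating `q` gives
`𝒞 w = lam * w + O(κ)` for the capacitance matrix `𝒞` (`IsResonanceFamily.isOrder_capacitance`).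
Since the eigenspace of `lam` is a line, spanned by a real vector `W`, it follows that
`w = c W + O(κ)` (`exists_pseudoinverse`), and then the second relation gives the derivatives
(`IsResonanceFamily.exists_isOrder_sub`). As one of them has modulus one, `c` stays away from zero
(`IsResonanceFamily.isOrder_coeff_inv`), and dividing by `c` gives the normalized mode.

On the algebraic side, the coordinate subspace of a block is invariant under `𝒞`, and rows outside
all blocks are zero, so that `W` is supported in exactly one block (`exists_target_block`). With
`C = L⁻¹ Aᵀ S⁻¹ A` and `D = S⁻¹ A L⁻¹ Aᵀ` on this block, `β = S⁻¹ A W` is an eigenvector of `D`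
(`hasEigenvector_blockD`); it consists of the difference quotients (`slope`) of `W`.

The bounds are obtained as asymptotic estimates along a filter on the type of all admissible modes,
which makes them uniform in the mode.
-/

namespace ResonatorChain

/-! ### Elementary facts on the chain -/

lemma t_one (x : ℕ → ℝ) (j : ℕ) : t x 1 j = x (j + 1) - x j := by
  simp [t]

lemma t_one_pos {N : ℕ} {x : ℕ → ℝ} (hx : StrictMonoOn x (Set.Icc 1 (2 * N))) {j : ℕ}
    (h1 : 1 ≤ j) (h2 : j + 1 ≤ 2 * N) : 0 < t x 1 j := by
  rw [t_one, sub_pos]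
  exact hx ⟨h1, by omega⟩ ⟨by omega, h2⟩ (Nat.lt_succ_self j)

lemma invT_eq_zero {N : ℕ} {x : ℕ → ℝ} {r k : ℝ} {j : ℕ} (h : ¬ IsResonantIndex N x r k j) :
    invT N x r k j = 0 := if_neg h

lemma invT_eq {N : ℕ} {x : ℕ → ℝ} {r k : ℝ} {j : ℕ} (h : IsResonantIndex N x r k j) :
    invT N x r k j = 1 / t x r j := if_pos h

lemma invT_zero (N : ℕ) (x : ℕ → ℝ) (r k : ℝ) : invT N x r k 0 = 0 :=
  invT_eq_zero fun h => absurd h.1 (by omega)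

lemma invT_two_mul (N : ℕ) (x : ℕ → ℝ) (r k : ℝ) : invT N x r k (2 * N) = 0 :=
  invT_eq_zero fun h => by have := h.1; have := h.2.1; omega

lemma sum_fin_ite_eq {V : Type*} [AddCommMonoid V] {N : ℕ} (n : ℕ) (g : ℕ → V) :
    ∑ j : Fin N, (if (j : ℕ) = n then g j else 0) = if n < N then g n else 0 := by
  rw [Fin.sum_univ_eq_sum_range (fun j => if j = n then g j else 0) N]
  simp [Finset.sum_ite_eq']

/-- The action of the capacitance matrix. At the two ends of the chain the coupling coefficient
vanishes, so that the values `f (i - 1)` for `i = 0` and `f (i + 1)` for `i + 1 = N` are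
irrelevant. -/
lemma sum_capacitance_smul {V : Type*} [AddCommGroup V] [Module ℝ V] (N : ℕ) (x : ℕ → ℝ) (r k : ℝ)
    (f : ℕ → V) (i : Fin N) :
    ∑ j : Fin N, capacitance N x r k i j • f j =
      theta N x r k (2 * i) • (f i - f (i - 1)) +
        theta N x r k (2 * i + 1) • (f i - f (i + 1)) := by
  obtain ⟨i, hi⟩ := i
  -- The last term corrects for `i = 0`, where `i - 1 = i`.
  have key : ∀ j : Fin N, capacitance N x r k ⟨i, hi⟩ j • f j =
      (if (j : ℕ) = i then (theta N x r k (2 * i) + theta N x r k (2 * i + 1)) • f j else 0) +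
      (if (j : ℕ) = i - 1 then -(theta N x r k (2 * i)) • f j else 0) +
      (if (j : ℕ) = i + 1 then -(theta N x r k (2 * i + 1)) • f j else 0) +
      (if (j : ℕ) = i - 1 then (if i = 0 then theta N x r k 0 • f 0 else 0) else 0) := by
    intro ⟨j, hj⟩
    simp only [capacitance]
    rcases Nat.eq_zero_or_pos i with rfl | h0
    · by_cases h : j = 0
      · subst h; simp [add_smul, add_comm]
      · simp [h, Ne.symm h, eq_comm]
    · by_cases h : j = i
      · subst h; simp [show j ≠ j - 1 by omega]
      · by_cases h' : j = i - 1
        · simp [h', show i ≠ i - 1 by omega, show i - 1 ≠ i by omega, show i - 1 + 1 = i by omega,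
            show i - 1 ≠ i + 1 by omega, show i ≠ 0 by omega]
        · by_cases h2 : j = i + 1
          · simp [h2, show i + 1 ≠ i - 1 by omega, show i + 1 + 1 ≠ i by omega]
          · simp [h, h', h2, Ne.symm h, Ne.symm h2, show j + 1 ≠ i by omega]
  rw [Finset.sum_congr rfl fun j _ => key j, Finset.sum_add_distrib, Finset.sum_add_distrib,
    Finset.sum_add_distrib, sum_fin_ite_eq i fun j => _ • f j,
    sum_fin_ite_eq (i - 1) fun j => -_ • f j, sum_fin_ite_eq (i + 1) fun j => -_ • f j,
    sum_fin_ite_eq (i - 1) fun _ => _]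
  have h0 : theta N x r k 0 = 0 := by simp [theta, invT_zero]
  have hN : ¬ i + 1 < N → theta N x r k (2 * i + 1) = 0 := fun h => by
    rw [theta, show 2 * i + 1 + 1 = 2 * N by omega, invT_two_mul, mul_zero]
  simp only [hi, show i - 1 < N by omega, if_true, h0, zero_smul, ite_self]
  split_ifs with h
  · module
  · rw [hN h]; module

/-! ### Simple eigenvalues -/

/-- The eigenspace of an eigenvalue of algebraic multiplicity one is a line. -/
lemma exists_smul_of_rootMultiplicity_eq_one {n : Type*} [Fintype n] [DecidableEq n]
    {T : Matrix n n ℝ} {lam : ℝ} (h : T.charpoly.rootMultiplicity lam = 1) {v w : n → ℝ}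
    (hw : w ≠ 0) (hTw : T.mulVec w = lam • w) (hTv : T.mulVec v = lam • v) :
    ∃ c : ℝ, v = c • w := by
  have h1 := LinearMap.finrank_eigenspace_le (Matrix.toLin' T) lam
  rw [Matrix.charpoly_toLin', h] at h1
  have hmem : ∀ v, T.mulVec v = lam • v → v ∈ (Module.End.eigenspace (Matrix.toLin' T) lam) :=
    fun v hv => Module.End.mem_eigenspace_iff.2 (by simpa using hv)
  obtain ⟨z, hz⟩ := finrank_le_one_iff.1 h1
  obtain ⟨c, hc⟩ := hz ⟨w, hmem w hTw⟩
  obtain ⟨c', hc'⟩ := hz ⟨v, hmem v hTv⟩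
  have hc1 : c • (z : n → ℝ) = w := by simpa using congrArg Subtype.val hc
  have hc2 : c' • (z : n → ℝ) = v := by simpa using congrArg Subtype.val hc'
  have hc0 : c ≠ 0 := by rintro rfl; exact hw (by rw [← hc1, zero_smul])
  exact ⟨c' / c, by rw [← hc1, ← hc2, smul_smul, div_mul_cancel₀ _ hc0]⟩

lemma exists_eigenvector_of_isRoot {n : Type*} [Fintype n] [DecidableEq n]
    {T : Matrix n n ℝ} {lam : ℝ} (h : T.charpoly.IsRoot lam) :
    ∃ w : n → ℝ, w ≠ 0 ∧ T.mulVec w = lam • w := by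
  rw [← Matrix.charpoly_toLin', ← Module.End.hasEigenvalue_iff_isRoot_charpoly] at h
  obtain ⟨w, hw⟩ := h.exists_hasEigenvector
  exact ⟨w, hw.2, by simpa using hw.apply_eq_smul⟩

lemma isRoot_charpoly_of_eigenvector {n : Type*} [Fintype n] [DecidableEq n]
    {T : Matrix n n ℝ} {lam : ℝ} {w : n → ℝ} (hw : w ≠ 0) (h : T.mulVec w = lam • w) :
    T.charpoly.IsRoot lam := by
  rw [← Matrix.charpoly_toLin', ← Module.End.hasEigenvalue_iff_isRoot_charpoly]
  exact Module.End.hasEigenvalue_of_hasEigenvector (x := w)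
    ⟨Module.End.mem_eigenspace_iff.2 (by simpa using h), hw⟩

/-- If the coordinate subspace given by `p` is invariant, then the characteristic polynomial of
the corresponding principal submatrix divides that of the matrix. -/
lemma charpoly_submatrix_dvd {n : Type*} [Fintype n] [DecidableEq n] {T : Matrix n n ℝ}
    (p : n → Prop) [DecidablePred p] (h : ∀ i, ¬ p i → ∀ j, p j → T i j = 0) :
    (T.submatrix (Subtype.val : {i // p i} → n) Subtype.val).charpoly ∣ T.charpoly := by
  have h2 := Matrix.twoBlockTriangular_det T.charmatrix p (fun i hi j hj => by
    have : i ≠ j := by rintro rfl; exact hi hj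
    rw [Matrix.charmatrix_apply_ne _ _ _ this, h i hi j hj]; simp)
  rw [Matrix.charpoly, Matrix.charpoly, h2]
  refine Dvd.intro (T.charmatrix.toSquareBlockProp fun i => ¬ p i).det ?_
  congr 2
  ext i j : 1
  by_cases hij : i = j
  · subst hij; simp [Matrix.toSquareBlockProp]
  · simp [Matrix.toSquareBlockProp, Matrix.charmatrix_apply_ne, hij,
      Subtype.val_injective.ne hij]

/-- A linear estimate near the kernel: if the kernel of `T` is spanned by the real vector `w`, then
a complex vector `v` is a multiple of `w` up to a fixed linear function of `T v`. -/
lemma exists_pseudoinverse {n : Type*} [Fintype n] [DecidableEq n] {T : Matrix n n ℝ} {w : n → ℝ}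
    (h : ∀ v : n → ℝ, T.mulVec v = 0 → ∃ c : ℝ, v = c • w) :
    ∃ G : Matrix n n ℝ, ∀ v : n → ℂ, ∃ c : ℂ, ∀ i,
      v i - c * w i = ∑ j, (G i j : ℂ) * ∑ l, (T j l : ℂ) * v l := by
  -- `G'` extends a right inverse of `T` onto its range, so that `T G' T = T`.
  obtain ⟨g, hg⟩ := (Matrix.toLin' T).rangeRestrict.exists_rightInverse_of_surjective
    (LinearMap.range_rangeRestrict _)
  obtain ⟨G', hG'⟩ := g.exists_extend
  have hreal : ∀ v : n → ℝ, ∃ c : ℝ, v - c • w = (LinearMap.toMatrix' G').mulVec (T.mulVec v) := by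
    intro v
    have h1 : T.mulVec (v - (LinearMap.toMatrix' G').mulVec (T.mulVec v)) = 0 := by
      have h2 : T.mulVec (g ((Matrix.toLin' T).rangeRestrict v)) = T.mulVec v := congrArg
        Subtype.val (LinearMap.congr_fun hg ((Matrix.toLin' T).rangeRestrict v))
      have h3 : G' (T.mulVec v) = g ((Matrix.toLin' T).rangeRestrict v) :=
        LinearMap.congr_fun hG' ((Matrix.toLin' T).rangeRestrict v)
      rw [Matrix.mulVec_sub, LinearMap.toMatrix'_mulVec, h3, h2, sub_self]
    obtain ⟨c, hc⟩ := h _ h1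
    exact ⟨c, by rw [← hc, sub_sub_cancel]⟩
  refine ⟨LinearMap.toMatrix' G', fun v => ?_⟩
  obtain ⟨a, ha⟩ := hreal fun i => (v i).re
  obtain ⟨b, hb⟩ := hreal fun i => (v i).im
  refine ⟨⟨a, b⟩, fun i => ?_⟩
  have ha := congrFun ha i
  have hb := congrFun hb i
  simp only [Pi.sub_apply, Pi.smul_apply, smul_eq_mul, Matrix.mulVec, dotProduct] at ha hb
  apply Complex.ext
  · simp [ha]
  · simp [hb]

/-! ### Resonant blocks -/

lemma exists_isResonantBlock {N : ℕ} {x : ℕ → ℝ} {r k : ℝ} {o : ℕ}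
    (ho : IsResonantIndex N x r k o) :
    ∃ a b, IsResonantBlock N x r k a b ∧ a ≤ o ∧ o ≤ b := by
  classical
  have hP : ∃ a, a ≤ o ∧ ∀ j, a ≤ j → j ≤ o → IsResonantIndex N x r k j :=
    ⟨o, le_rfl, fun j h1 h2 => by rwa [show j = o by omega]⟩
  have hQ : ∃ b, o ≤ b ∧ ¬ IsResonantIndex N x r k (b + 1) :=
    ⟨2 * N + o, by omega, fun h => by have := h.2.1; omega⟩
  obtain ⟨ha, ha'⟩ := Nat.find_spec hP
  obtain ⟨hb, hb'⟩ := Nat.find_spec hQ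
  have ha0 : 1 ≤ Nat.find hP := (ha' _ le_rfl ha).1
  refine ⟨Nat.find hP, Nat.find hQ, ⟨ha0, ha.trans hb, fun j h1 h2 => ?_, fun h => ?_, hb'⟩, ha, hb⟩
  · by_cases hj : j ≤ o
    · exact ha' j h1 hj
    · by_contra hres
      exact Nat.find_min hQ (m := j - 1) (by omega)
        ⟨by omega, by rwa [show j - 1 + 1 = j by omega]⟩
  · refine Nat.find_min hP (m := Nat.find hP - 1) (by omega) ⟨by omega, fun j h1 h2 => ?_⟩
    rcases Nat.eq_or_lt_of_le h1 with rfl | h1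
    · exact h
    · exact ha' j (by omega) h2

lemma IsResonantBlock.eq_of_mem {N : ℕ} {x : ℕ → ℝ} {r k : ℝ} {a b a' b' o : ℕ}
    (h : IsResonantBlock N x r k a b) (h' : IsResonantBlock N x r k a' b')
    (ho : a ≤ o ∧ o ≤ b) (ho' : a' ≤ o ∧ o ≤ b') : a' = a ∧ b' = b := by
  obtain ⟨h1, -, h3, h4, h5⟩ := h
  obtain ⟨h1', -, h3', h4', h5'⟩ := h'
  refine ⟨?_, ?_⟩
  · rcases lt_trichotomy a a' with hl | hl | hl
    · exact absurd (h3 (a' - 1) (by omega) (by omega)) h4'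
    · exact hl.symm
    · exact absurd (h3' (a - 1) (by omega) (by omega)) h4
  · rcases lt_trichotomy b b' with hl | hl | hl
    · exact absurd (h3' (b + 1) (by omega) (by omega)) h5
    · exact hl.symm
    · exact absurd (h3 (b' + 1) (by omega) (by omega)) h5'

/-- The capacitance matrix does not lead from a block to the outside of the block. -/
lemma IsResonantBlock.capacitance_eq_zero {N : ℕ} {x : ℕ → ℝ} {r k : ℝ} {a b : ℕ}
    (h : IsResonantBlock N x r k a b) {i j : Fin N}
    (hi : ¬ (a ≤ 2 * (i : ℕ) + 1 ∧ 2 * (i : ℕ) + 1 ≤ b))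
    (hj : a ≤ 2 * (j : ℕ) + 1 ∧ 2 * (j : ℕ) + 1 ≤ b) : capacitance N x r k i j = 0 := by
  obtain ⟨h1, -, h3, h4, h5⟩ := h
  have h4 := invT_eq_zero h4
  have h5 := invT_eq_zero h5
  unfold capacitance
  split_ifs with e1 e2 e3
  · omega
  · rcases (show 2 * (i : ℕ) = b + 1 ∨ 2 * (i : ℕ) + 1 = b + 1 by omega) with e | e
    · rw [theta, e, h5]; simp
    · rw [theta, e, h5]; simp
  · rcases (show 2 * (i : ℕ) + 1 + 1 = a - 1 ∨ 2 * (i : ℕ) + 1 = a - 1 by omega) with e | e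
    · rw [theta, e, h4]; simp
    · rw [theta, e, h4]; simp
  · rfl

/-- Entries of the capacitance matrix that lead from the outside into a block come from
nonresonant resonators. -/
lemma IsResonantBlock.not_isResonantIndex {N : ℕ} {x : ℕ → ℝ} {r k : ℝ} {a b : ℕ}
    (h : IsResonantBlock N x r k a b) {i j : Fin N}
    (hi : a ≤ 2 * (i : ℕ) + 1 ∧ 2 * (i : ℕ) + 1 ≤ b)
    (hj : ¬ (a ≤ 2 * (j : ℕ) + 1 ∧ 2 * (j : ℕ) + 1 ≤ b)) (hij : capacitance N x r k i j ≠ 0) :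
    ¬ IsResonantIndex N x r k (2 * j + 1) := by
  obtain ⟨h1, -, h3, h4, h5⟩ := h
  have h4' := invT_eq_zero h4
  have h5' := invT_eq_zero h5
  unfold capacitance at hij
  split_ifs at hij with e1 e2 e3
  · omega
  · rcases (show 2 * (i : ℕ) = a - 1 ∨ 2 * (j : ℕ) + 1 = a - 1 by omega) with e | e
    · rw [theta, e, h4'] at hij; simp at hij
    · rwa [e]
  · rcases (show 2 * (i : ℕ) + 1 + 1 = b + 1 ∨ 2 * (j : ℕ) + 1 = b + 1 by omega) with e | e
    · rw [theta, e, h5'] at hij; simp at hij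
    · rwa [e]
  · exact absurd rfl hij

lemma mulVec_eq_smul_iff_submatrix {n : Type*} [Fintype n] {T : Matrix n n ℝ}
    {p : n → Prop} [DecidablePred p] (h : ∀ i, ¬ p i → ∀ j, p j → T i j = 0) {v : n → ℝ}
    (hv : ∀ i, ¬ p i → v i = 0) (lam : ℝ) :
    T.mulVec v = lam • v ↔
      (T.submatrix (Subtype.val : {i // p i} → n) Subtype.val).mulVec
        (fun i : {i // p i} => v i) = lam • fun i : {i // p i} => v i := by
  have hsum : ∀ i, T.mulVec v i = ∑ j : {j // p j}, T i j * v j := by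
    intro i
    rw [Matrix.mulVec, dotProduct, ← Fintype.sum_subtype_add_sum_subtype p,
      Finset.sum_eq_zero (s := (Finset.univ : Finset {j // ¬ p j})), add_zero]
    intro j _
    rw [hv j j.2, mul_zero]
  constructor
  · intro H
    ext i
    have := congrFun H i
    rw [hsum] at this
    simpa [Matrix.mulVec, dotProduct] using this
  · intro H
    ext i
    rw [hsum]
    by_cases hi : p i
    · simpa [Matrix.mulVec, dotProduct] using congrFun H ⟨i, hi⟩
    · rw [Finset.sum_eq_zero fun j _ => by rw [h i hi j j.2, zero_mul]]
      simp [hv i hi]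

/-- The target block. The eigenvector of the capacitance matrix is given as a sequence `W` that
vanishes outside the block, and its eigenvalue equation is written out. -/
theorem exists_target_block {N : ℕ} {x : ℕ → ℝ} {r k lam : ℝ} (hlam : lam ≠ 0)
    (hsimple : (capacitance N x r k).charpoly.rootMultiplicity lam = 1) :
    ∃ a b : ℕ, IsResonantBlock N x r k a b ∧
      (blockC N x r k a b).charpoly.rootMultiplicity lam = 1 ∧
      (∀ a' b' : ℕ, IsResonantBlock N x r k a' b' →
        (blockC N x r k a' b').charpoly.IsRoot lam → a' = a ∧ b' = b) ∧
      ∃ W : ℕ → ℝ, (∃ i, W i ≠ 0) ∧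
        (∀ i, ¬ (a ≤ 2 * i + 1 ∧ 2 * i + 1 ≤ b) → W i = 0) ∧
        (∀ i < N, theta N x r k (2 * i) * (W i - W (i - 1)) +
          theta N x r k (2 * i + 1) * (W i - W (i + 1)) = lam * W i) ∧
        ∀ v : Fin N → ℝ, (capacitance N x r k).mulVec v = lam • v →
          ∃ c : ℝ, v = c • fun i : Fin N => W i := by
  set C := capacitance N x r k with hC
  have hroot : C.charpoly.IsRoot lam := by
    by_contra h
    rw [Polynomial.rootMultiplicity_eq_zero h] at hsimple
    omega
  have hmem : ∀ (a b : ℕ) (i : Fin N), (a / 2 + 1 ≤ (i : ℕ) + 1 ∧ (i : ℕ) + 1 ≤ (b + 1) / 2) ↔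
      (a ≤ 2 * (i : ℕ) + 1 ∧ 2 * (i : ℕ) + 1 ≤ b) := fun a b i => by omega
  have hinv : ∀ {a b : ℕ}, IsResonantBlock N x r k a b → ∀ i : Fin N,
      ¬ (a / 2 + 1 ≤ (i : ℕ) + 1 ∧ (i : ℕ) + 1 ≤ (b + 1) / 2) → ∀ j : Fin N,
      (a / 2 + 1 ≤ (j : ℕ) + 1 ∧ (j : ℕ) + 1 ≤ (b + 1) / 2) → C i j = 0 := by
    intro a b hab i hi j hj
    exact hab.capacitance_eq_zero (by rwa [← hmem]) (by rwa [← hmem])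
  obtain ⟨w, hw0, hw⟩ := exists_eigenvector_of_isRoot hroot
  have hrow : ∀ i : Fin N, ¬ IsResonantIndex N x r k (2 * i + 1) → w i = 0 := by
    intro i hi
    have hi := invT_eq_zero hi
    have h1 := congrFun hw i
    have h2 : ∀ j, C i j = 0 := fun j => by
      simp [hC, capacitance, theta, hi]
    simp only [Matrix.mulVec, dotProduct, h2, zero_mul, Finset.sum_const_zero, Pi.smul_apply,
      smul_eq_mul] at h1
    exact (mul_eq_zero.1 h1.symm).resolve_left hlam
  obtain ⟨i₀, hi₀⟩ := Function.ne_iff.1 hw0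
  obtain ⟨a, b, hab, hia, hib⟩ := exists_isResonantBlock (not_imp_comm.1 (hrow i₀) hi₀)
  -- The restriction of `w` to the block is again an eigenvector.
  set w' : Fin N → ℝ := fun i => if a ≤ 2 * (i : ℕ) + 1 ∧ 2 * (i : ℕ) + 1 ≤ b then w i else 0
    with hw'
  have hw'i : w' i₀ ≠ 0 := by rwa [show w' i₀ = w i₀ from if_pos ⟨hia, hib⟩]
  have hw'0 : w' ≠ 0 := Function.ne_iff.2 ⟨i₀, hw'i⟩
  have hw'e : C.mulVec w' = lam • w' := by
    ext i
    have h1 := congrFun hw i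
    simp only [Matrix.mulVec, dotProduct, Pi.smul_apply, smul_eq_mul] at h1 ⊢
    by_cases hi : a ≤ 2 * (i : ℕ) + 1 ∧ 2 * (i : ℕ) + 1 ≤ b
    · rw [show w' i = w i from if_pos hi, ← h1]
      refine Finset.sum_congr rfl fun j _ => ?_
      by_cases hj : a ≤ 2 * (j : ℕ) + 1 ∧ 2 * (j : ℕ) + 1 ≤ b
      · rw [show w' j = w j from if_pos hj]
      · rw [show w' j = 0 from if_neg hj]
        by_cases hij : C i j = 0
        · rw [hij, zero_mul, zero_mul]
        · rw [hrow j (hab.not_isResonantIndex hi hj hij)]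
    · rw [show w' i = 0 from if_neg hi, mul_zero]
      refine Finset.sum_eq_zero fun j _ => ?_
      by_cases hj : a ≤ 2 * (j : ℕ) + 1 ∧ 2 * (j : ℕ) + 1 ≤ b
      · rw [hC, hab.capacitance_eq_zero hi hj, zero_mul]
      · rw [show w' j = 0 from if_neg hj, mul_zero]
  have hw'b : ∀ i : Fin N, ¬ (a / 2 + 1 ≤ (i : ℕ) + 1 ∧ (i : ℕ) + 1 ≤ (b + 1) / 2) → w' i = 0 :=
    fun i hi => if_neg (by rwa [← hmem])
  have hline : ∀ v : Fin N → ℝ, C.mulVec v = lam • v → ∃ c : ℝ, v = c • w' := fun v hv =>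
    exists_smul_of_rootMultiplicity_eq_one hsimple hw'0 hw'e hv
  refine ⟨a, b, hab, ?_, ?_, fun i => if h : i < N then w' ⟨i, h⟩ else 0, ?_, ?_, ?_, ?_⟩
  · refine le_antisymm ?_ ?_
    · refine le_of_le_of_eq ?_ hsimple
      exact Polynomial.rootMultiplicity_le_rootMultiplicity_of_dvd (Matrix.charpoly_monic C).ne_zero
        (charpoly_submatrix_dvd _ (hinv hab)) lam
    · refine (Polynomial.rootMultiplicity_pos (Matrix.charpoly_monic _).ne_zero).2 ?_
      refine isRoot_charpoly_of_eigenvector (w := fun i => w' i) ?_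
        ((mulVec_eq_smul_iff_submatrix (hinv hab) hw'b lam).1 hw'e)
      exact Function.ne_iff.2 ⟨⟨i₀, (hmem _ _ _).2 ⟨hia, hib⟩⟩, hw'i⟩
  · intro a' b' hab' hroot'
    obtain ⟨f, hf0, hf⟩ := exists_eigenvector_of_isRoot hroot'
    set g : Fin N → ℝ := fun i =>
      if h : a' / 2 + 1 ≤ (i : ℕ) + 1 ∧ (i : ℕ) + 1 ≤ (b' + 1) / 2 then f ⟨i, h⟩ else 0 with hg
    have hgf : (fun i : {i : Fin N // a' / 2 + 1 ≤ (i : ℕ) + 1 ∧ (i : ℕ) + 1 ≤ (b' + 1) / 2} =>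
        g i) = f := by
      ext i
      exact dif_pos i.2
    have hg0 : ∀ i : Fin N, ¬ (a' / 2 + 1 ≤ (i : ℕ) + 1 ∧ (i : ℕ) + 1 ≤ (b' + 1) / 2) →
      g i = 0 := fun i hi => dif_neg hi
    have hge : C.mulVec g = lam • g :=
      (mulVec_eq_smul_iff_submatrix (hinv hab') hg0 lam).2 (by rw [hgf]; exact hf)
    obtain ⟨c, hc⟩ := hline g hge
    -- Both eigenvectors span the same line, so that their supports agree.
    obtain ⟨j, hj⟩ := Function.ne_iff.1 hf0
    have hgj : g j ≠ 0 := by rw [← hgf] at hj; exact hj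
    have hwj : w' j ≠ 0 := fun h => hgj (by rw [hc, Pi.smul_apply, h, smul_zero])
    exact hab.eq_of_mem hab' (o := 2 * (j : ℕ) + 1) ((hmem _ _ _).1 (not_imp_comm.1 (hw'b j) hwj))
      ((hmem _ _ _).1 j.2)
  · exact ⟨i₀, by simpa using hw'i⟩
  · intro i hi
    dsimp only
    split_ifs with h
    · exact if_neg hi
    · rfl
  · intro i hi
    have h1 := congrFun hw'e ⟨i, hi⟩
    have h2 := sum_capacitance_smul N x r k
      (fun i => if h : i < N then w' ⟨i, h⟩ else 0) ⟨i, hi⟩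
    simp only [smul_eq_mul, Fin.is_lt, dif_pos, Fin.eta] at h2
    rw [← h2]
    simpa [Matrix.mulVec, dotProduct, hi] using h1
  · simpa using hline

/-! ### The matrix of the spacings of a block -/

/-- The leading coefficient of the derivative at the spacing with the (even) index `e`, in terms
of the values `W` at the resonators: the difference quotient of `W` over a resonant spacing, and
zero for all other spacings. -/
noncomputable def slope (N : ℕ) (x : ℕ → ℝ) (r k : ℝ) (W : ℕ → ℝ) (e : ℕ) : ℝ :=
  invT N x r k e * (W (e / 2) - W (e / 2 - 1))

theorem hasEigenvector_blockD {N : ℕ} {x : ℕ → ℝ} {r k lam : ℝ} {a b : ℕ} {W : ℕ → ℝ}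
    (ht : ∀ j, IsResonantIndex N x r k j → t x r j ≠ 0)
    (hlam : lam ≠ 0) (hab : IsResonantBlock N x r k a b) (hW0 : ∃ i, W i ≠ 0)
    (hWs : ∀ i, ¬ (a ≤ 2 * i + 1 ∧ 2 * i + 1 ≤ b) → W i = 0)
    (hW : ∀ i < N, theta N x r k (2 * i) * (W i - W (i - 1)) +
      theta N x r k (2 * i + 1) * (W i - W (i + 1)) = lam * W i) :
    Module.End.HasEigenvector (Matrix.toLin' (blockD x r a b)) lam
      fun j => slope N x r k W (evenIndex a j) := by
  obtain ⟨h1, h12, h3, h4, h5⟩ := hab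
  have h4' := invT_eq_zero h4
  have h5' := invT_eq_zero h5
  have hmod := Nat.mod_lt a (show 2 > 0 by norm_num)
  set β : Fin (numEven a b) → ℝ := fun j => slope N x r k W (evenIndex a j) with hβ
  have hodd : ∀ c : Fin (numOdd a b), IsResonantIndex N x r k (oddIndex a c) := fun ⟨c, hc⟩ => by
    unfold numOdd at hc
    exact h3 _ (by simp only [oddIndex]; omega) (by simp only [oddIndex]; omega)
  have heven : ∀ c : Fin (numEven a b), IsResonantIndex N x r k (evenIndex a c) :=
    fun ⟨c, hc⟩ => by
      unfold numEven at hc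
      exact h3 _ (by simp only [evenIndex]; omega) (by simp only [evenIndex]; omega)
  have hSinv : (diagEven x r a b)⁻¹ = Matrix.diagonal fun i : Fin (numEven a b) =>
      (t x r (evenIndex a i))⁻¹ := by
    refine Matrix.inv_eq_left_inv ?_
    rw [diagEven, Matrix.diagonal_mul_diagonal, ← Matrix.diagonal_one]
    congr 1; ext i; exact inv_mul_cancel₀ (ht _ (heven i))
  have hLinv : (diagOdd x r a b)⁻¹ = Matrix.diagonal fun i : Fin (numOdd a b) =>
      (t x r (oddIndex a i))⁻¹ := by
    refine Matrix.inv_eq_left_inv ?_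
    rw [diagOdd, Matrix.diagonal_mul_diagonal, ← Matrix.diagonal_one]
    congr 1; ext i; exact inv_mul_cancel₀ (ht _ (hodd i))
  -- The slopes vanish at the two ends of the block, so that no boundary terms appear.
  have hAT : ∀ c : Fin (numOdd a b), ((diffMatrix a b).transpose.mulVec β) c =
      slope N x r k W (oddIndex a c - 1) - slope N x r k W (oddIndex a c + 1) := by
    rintro ⟨c, hc⟩
    have hc' := hc
    unfold numOdd at hc'
    have e1 : ∀ i : Fin (numEven a b), (diffMatrix a b).transpose ⟨c, hc⟩ i * β i =
        (if (i : ℕ) = c + 1 - a % 2 then -slope N x r k W (evenIndex a i) else 0) +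
        (if (i : ℕ) = c - a % 2 then
          (if a % 2 ≤ c then slope N x r k W (evenIndex a i) else 0) else 0) := by
      intro i
      simp only [hβ, Matrix.transpose_apply, diffMatrix]
      split_ifs <;> first | omega | simp
    rw [Matrix.mulVec, dotProduct, Finset.sum_congr rfl fun i _ => e1 i, Finset.sum_add_distrib,
      sum_fin_ite_eq _ fun i => -slope N x r k W (evenIndex a i),
      sum_fin_ite_eq _ fun i => if a % 2 ≤ c then slope N x r k W (evenIndex a i) else 0,
      sub_eq_neg_add]
    congr 1
    · split_ifs with hn
      · congr 2; simp only [evenIndex, oddIndex]; omega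
      · unfold numEven at hn
        rw [slope, show oddIndex a c + 1 = b + 1 by simp only [oddIndex]; omega, h5', zero_mul,
          neg_zero]
    · have hlast : ¬ (c - a % 2 < numEven a b ∧ a % 2 ≤ c) →
          slope N x r k W (oddIndex a c - 1) = 0 := by
        intro hn
        unfold numEven at hn
        rw [slope, show oddIndex a c - 1 = a - 1 by simp only [oddIndex]; omega, h4', zero_mul]
      split_ifs with hn hn'
      · congr 1; simp only [evenIndex, oddIndex]; omega
      · exact (hlast (by tauto)).symm
      · exact (hlast (by tauto)).symm
  have hLAT : ∀ c : Fin (numOdd a b), (t x r (oddIndex a c))⁻¹ *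
      ((diffMatrix a b).transpose.mulVec β) c = lam * W (a / 2 + c) := by
    intro c
    have hres := hodd c
    have hc := hres.2.1
    rw [hAT c, ← hW (a / 2 + c) (by simp only [oddIndex] at hc; omega), theta, theta]
    rw [show 2 * (a / 2 + (c : ℕ)) + 1 = oddIndex a c by simp only [oddIndex]; omega,
      show 2 * (a / 2 + (c : ℕ)) = oddIndex a c - 1 by simp only [oddIndex]; omega,
      invT_eq hres, slope, slope,
      show (oddIndex a c - 1) / 2 = a / 2 + c by simp only [oddIndex]; omega,
      show (oddIndex a c + 1) / 2 = a / 2 + c + 1 by simp only [oddIndex]; omega,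
      show a / 2 + (c : ℕ) + 1 - 1 = a / 2 + c by omega]
    ring
  have hA : ∀ i : Fin (numEven a b), ((diffMatrix a b).mulVec
      fun c : Fin (numOdd a b) => lam * W (a / 2 + c)) i =
      lam * (W (evenIndex a i / 2) - W (evenIndex a i / 2 - 1)) := by
    rintro ⟨i, hi⟩
    have hi' := hi
    unfold numEven at hi'
    have e1 : ∀ c : Fin (numOdd a b), diffMatrix a b ⟨i, hi⟩ c * (lam * W (a / 2 + c)) =
        (if (c : ℕ) = i + a % 2 then lam * W (a / 2 + c) else 0) +
        (if (c : ℕ) = i + a % 2 - 1 then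
          (if 1 ≤ i + a % 2 then -(lam * W (a / 2 + c)) else 0) else 0) := by
      intro c
      simp only [diffMatrix]
      split_ifs <;> first | omega | simp
    rw [Matrix.mulVec, dotProduct, Finset.sum_congr rfl fun i _ => e1 i, Finset.sum_add_distrib,
      sum_fin_ite_eq _ fun c => lam * W (a / 2 + c),
      sum_fin_ite_eq _ fun c => if 1 ≤ i + a % 2 then -(lam * W (a / 2 + c)) else 0,
      mul_sub, sub_eq_add_neg]
    congr 1
    · split_ifs with hn
      · congr 2; simp only [evenIndex]; omega
      · unfold numOdd at hn
        rw [hWs, mul_zero]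
        simp only [evenIndex]; omega
    · have hlast : ¬ (i + a % 2 - 1 < numOdd a b ∧ 1 ≤ i + a % 2) →
          W (evenIndex a i / 2 - 1) = 0 := by
        intro hn
        unfold numOdd at hn
        exact hWs _ (by simp only [evenIndex]; omega)
      split_ifs with hn hn'
      · congr 3; simp only [evenIndex]; omega
      · rw [hlast (by tauto)]; simp
      · rw [hlast (by tauto)]; simp
  refine ⟨Module.End.mem_eigenspace_iff.2 ?_, ?_⟩
  · rw [Matrix.toLin'_apply, blockD, hSinv, hLinv, ← Matrix.mulVec_mulVec, ← Matrix.mulVec_mulVec,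
      ← Matrix.mulVec_mulVec]
    have e2 : (Matrix.diagonal fun i : Fin (numOdd a b) => (t x r (oddIndex a i))⁻¹).mulVec
        ((diffMatrix a b).transpose.mulVec β) = fun c : Fin (numOdd a b) => lam * W (a / 2 + c) := by
      ext c
      rw [Matrix.mulVec_diagonal, hLAT c]
    rw [e2]
    ext i
    rw [Matrix.mulVec_diagonal, hA i, Pi.smul_apply, smul_eq_mul, hβ]
    simp only [slope, invT_eq (heven i)]
    ring
  · intro h0
    obtain ⟨i, hi⟩ := hW0
    have hi2 := not_imp_comm.1 (hWs i) hi
    have := hLAT ⟨i - a / 2, by unfold numOdd; omega⟩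
    rw [h0, Matrix.mulVec_zero, Pi.zero_apply, mul_zero,
      show a / 2 + (i - a / 2) = i by omega] at this
    exact mul_ne_zero hlam hi this.symm

/-! ### Solutions of the Helmholtz equation on an interval -/

lemma eq_of_hasDerivAt_zero_of_tendsto {f : ℝ → ℂ} {p q : ℝ} {l : Filter ℝ} [l.NeBot] {c : ℂ}
    (hf : ∀ y ∈ Set.Ioo p q, HasDerivAt f 0 y) (hl : Set.Ioo p q ∈ l) (hc : Tendsto f l (𝓝 c))
    {y : ℝ} (hy : y ∈ Set.Ioo p q) : f y = c := by
  have hconst : ∀ z ∈ Set.Ioo p q, f z = f y := fun z hz =>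
    isOpen_Ioo.is_const_of_deriv_eq_zero isPreconnected_Ioo
      (fun z hz => (hf z hz).differentiableAt.differentiableWithinAt)
      (fun z hz => (hf z hz).deriv) hz hy
  refine tendsto_nhds_unique (tendsto_const_nhds.congr' ?_) hc
  filter_upwards [hl] with z hz using (hconst z hz).symm

/-- A solution of `u'' + k² u = 0` in terms of its value and its derivative at the left end. The
formula is multiplied by `k`, so that it holds for `k = 0` as well. -/
lemma helmholtz_interval {k : ℂ} {u : ℝ → ℂ} {p q : ℝ} (hpq : p < q) (hu : Continuous u)
    (hode : ∀ y ∈ Set.Ioo p q, DifferentiableAt ℝ u y ∧ DifferentiableAt ℝ (deriv u) y ∧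
      deriv (deriv u) y + k ^ 2 * u y = 0) {d d' : ℂ}
    (hd : Tendsto (deriv u) (𝓝[>] p) (𝓝 d)) (hd' : Tendsto (deriv u) (𝓝[<] q) (𝓝 d')) :
    (∀ y ∈ Set.Icc p q, k * u y = k * u p * Complex.cos (k * (y - p : ℝ)) +
      d * Complex.sin (k * (y - p : ℝ))) ∧
    d' = d * Complex.cos (k * (q - p : ℝ)) - k * u p * Complex.sin (k * (q - p : ℝ)) := by
  have hlin : ∀ y : ℝ, HasDerivAt (fun y : ℝ => k * ((y - p : ℝ) : ℂ)) k y := fun y => by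
    simpa using (((hasDerivAt_id y).sub_const p).ofReal_comp).const_mul k
  have hcos : ∀ y : ℝ, HasDerivAt (fun y : ℝ => Complex.cos (k * ((y - p : ℝ) : ℂ)))
      (-Complex.sin (k * ((y - p : ℝ) : ℂ)) * k) y := fun y =>
    (Complex.hasDerivAt_cos _).comp_of_eq y (hlin y) rfl
  have hsin : ∀ y : ℝ, HasDerivAt (fun y : ℝ => Complex.sin (k * ((y - p : ℝ) : ℂ)))
      (Complex.cos (k * ((y - p : ℝ) : ℂ)) * k) y := fun y =>
    (Complex.hasDerivAt_sin _).comp_of_eq y (hlin y) rfl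
  have hcosc : Continuous fun y : ℝ => Complex.cos (k * ((y - p : ℝ) : ℂ)) := by fun_prop
  have hsinc : Continuous fun y : ℝ => Complex.sin (k * ((y - p : ℝ) : ℂ)) := by fun_prop
  -- Two first integrals of the equation.
  have h1 : ∀ y ∈ Set.Ioo p q, Complex.cos (k * ((y - p : ℝ) : ℂ)) * deriv u y +
      Complex.sin (k * ((y - p : ℝ) : ℂ)) * (k * u y) = d := by
    intro y hy
    refine eq_of_hasDerivAt_zero_of_tendsto (l := 𝓝[>] p) (y := y)
      (f := fun y => Complex.cos (k * ((y - p : ℝ) : ℂ)) * deriv u y +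
        Complex.sin (k * ((y - p : ℝ) : ℂ)) * (k * u y)) (fun z hz => ?_)
      (Ioo_mem_nhdsGT hpq) ?_ hy
    · obtain ⟨e1, e2, e3⟩ := hode z hz
      refine (((hcos z).fun_mul e2.hasDerivAt).fun_add
        ((hsin z).fun_mul (e1.hasDerivAt.const_mul k))).congr_deriv ?_
      linear_combination Complex.cos (k * ((z - p : ℝ) : ℂ)) * e3
    · have := ((hcosc.tendsto p).mono_left nhdsWithin_le_nhds |>.mul hd).add
        (((hsinc.mul (hu.const_mul k)).tendsto p).mono_left (nhdsWithin_le_nhds (s := Set.Ioi p)))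
      simpa using this
  have h2 : ∀ y ∈ Set.Ioo p q, Complex.cos (k * ((y - p : ℝ) : ℂ)) * (k * u y) -
      Complex.sin (k * ((y - p : ℝ) : ℂ)) * deriv u y = k * u p := by
    intro y hy
    refine eq_of_hasDerivAt_zero_of_tendsto (l := 𝓝[>] p) (y := y)
      (f := fun y => Complex.cos (k * ((y - p : ℝ) : ℂ)) * (k * u y) -
        Complex.sin (k * ((y - p : ℝ) : ℂ)) * deriv u y) (fun z hz => ?_)
      (Ioo_mem_nhdsGT hpq) ?_ hy
    · obtain ⟨e1, e2, e3⟩ := hode z hz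
      refine (((hcos z).fun_mul (e1.hasDerivAt.const_mul k)).fun_sub
        ((hsin z).fun_mul e2.hasDerivAt)).congr_deriv ?_
      linear_combination -Complex.sin (k * ((z - p : ℝ) : ℂ)) * e3
    · have := (((hcosc.mul (hu.const_mul k)).tendsto p).mono_left
        (nhdsWithin_le_nhds (s := Set.Ioi p))).sub
        ((hsinc.tendsto p).mono_left nhdsWithin_le_nhds |>.mul hd)
      simpa using this
  have h3 : ∀ y ∈ Set.Ioo p q, k * u y = k * u p * Complex.cos (k * (y - p : ℝ)) +
      d * Complex.sin (k * (y - p : ℝ)) := by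
    intro y hy
    linear_combination Complex.cos (k * (y - p : ℝ)) * h2 y hy +
      Complex.sin (k * (y - p : ℝ)) * h1 y hy -
      k * u y * Complex.sin_sq_add_cos_sq (k * ((y - p : ℝ) : ℂ))
  refine ⟨fun y hy => ?_, ?_⟩
  · have hcl : IsClosed {y : ℝ | k * u y = k * u p * Complex.cos (k * (y - p : ℝ)) +
      d * Complex.sin (k * (y - p : ℝ))} := isClosed_eq (by fun_prop) (by fun_prop)
    rw [← closure_Ioo hpq.ne] at hy
    exact hcl.closure_subset_iff.2 h3 hy
  · refine tendsto_nhds_unique hd' (Tendsto.congr' (f₁ := fun y : ℝ =>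
      d * Complex.cos (k * (y - p : ℝ)) - k * u p * Complex.sin (k * (y - p : ℝ))) ?_ ?_)
    · filter_upwards [Ioo_mem_nhdsLT hpq] with y hy
      linear_combination Complex.sin (k * (y - p : ℝ)) * h2 y hy -
        Complex.cos (k * (y - p : ℝ)) * h1 y hy +
        deriv u y * Complex.sin_sq_add_cos_sq (k * ((y - p : ℝ) : ℂ))
    · exact Tendsto.mono_left (Continuous.tendsto (by fun_prop) q) nhdsWithin_le_nhds

/-- A solution of `u' = i m u` on an interval vanishes if it tends to zero along some filter on
the interval, e.g. at one of its ends. -/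
lemma eq_zero_of_deriv_eq_mul {m : ℂ} {u : ℝ → ℂ} {p q z : ℝ} (hu : Continuous u) (hz : u z = 0)
    {l : Filter ℝ} [l.NeBot] (hl : Set.Ioo p q ∈ l) (hlz : l ≤ 𝓝 z)
    (hode : ∀ y ∈ Set.Ioo p q, DifferentiableAt ℝ u y ∧ deriv u y = m * u y)
    {y : ℝ} (hy : y ∈ Set.Ioo p q) : u y = 0 := by
  have hexp : ∀ y : ℝ, HasDerivAt (fun y : ℝ => Complex.exp (-m * y))
      (Complex.exp (-m * y) * -m) y := fun y =>
    (Complex.hasDerivAt_exp _).comp_of_eq y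
      (by simpa using (hasDerivAt_id y).ofReal_comp.const_mul (-m)) rfl
  have h : Complex.exp (-m * y) * u y = 0 := by
    refine eq_of_hasDerivAt_zero_of_tendsto (l := l) (y := y)
      (f := fun y : ℝ => Complex.exp (-m * y) * u y) (fun w hw => ?_) hl ?_ hy
    · obtain ⟨e1, e2⟩ := hode w hw
      refine ((hexp w).fun_mul e1.hasDerivAt).congr_deriv ?_
      rw [e2]; ring
    · have : Continuous fun y : ℝ => Complex.exp (-m * y) * u y := by fun_prop
      simpa [hz] using (this.tendsto z).mono_left hlz
  exact (mul_eq_zero.1 h).resolve_left (Complex.exp_ne_zero _)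

/-! ### The transfer equations of an eigenmode -/

/-- The equations that link the values `u (x j)` and the one-sided derivatives `D j` of an
eigenmode at the end points of the resonators, where `D j` is taken on the side outside the
resonator. -/
structure HasOuterDerivs (N : ℕ) (x : ℕ → ℝ) (δ k : ℂ) (u : ℝ → ℂ) (D : ℕ → ℂ) : Prop where
  resonator : ∀ i < N, ∀ y ∈ Set.Icc (x (2 * i + 1)) (x (2 * i + 2)),
    k * u y = k * u (x (2 * i + 1)) * Complex.cos (k * (y - x (2 * i + 1) : ℝ)) +
      δ * D (2 * i + 1) * Complex.sin (k * (y - x (2 * i + 1) : ℝ))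
  resonator_deriv : ∀ i < N, δ * D (2 * i + 2) =
    δ * D (2 * i + 1) * Complex.cos (k * t x 1 (2 * i + 1)) -
      k * u (x (2 * i + 1)) * Complex.sin (k * t x 1 (2 * i + 1))
  spacing : ∀ i, i + 1 < N → ∀ y ∈ Set.Icc (x (2 * i + 2)) (x (2 * i + 3)),
    k * u y = k * u (x (2 * i + 2)) * Complex.cos (k * (y - x (2 * i + 2) : ℝ)) +
      D (2 * i + 2) * Complex.sin (k * (y - x (2 * i + 2) : ℝ))
  spacing_deriv : ∀ i, i + 1 < N → D (2 * i + 3) =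
    D (2 * i + 2) * Complex.cos (k * t x 1 (2 * i + 2)) -
      k * u (x (2 * i + 2)) * Complex.sin (k * t x 1 (2 * i + 2))
  left : D 1 = -(Complex.I * k * u (x 1))
  right : D (2 * N) = Complex.I * k * u (x (2 * N))

lemma HasOuterDerivs.const_mul {N : ℕ} {x : ℕ → ℝ} {δ k : ℂ} {u : ℝ → ℂ} {D : ℕ → ℂ}
    (h : HasOuterDerivs N x δ k u D) (c : ℂ) :
    HasOuterDerivs N x δ k (fun y => c * u y) (fun j => c * D j) where
  resonator i hi y hy := by linear_combination c * h.resonator i hi y hy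
  resonator_deriv i hi := by linear_combination c * h.resonator_deriv i hi
  spacing i hi y hy := by linear_combination c * h.spacing i hi y hy
  spacing_deriv i hi := by linear_combination c * h.spacing_deriv i hi
  left := by linear_combination c * h.left
  right := by linear_combination c * h.right

lemma notMem_closure_resonators {N : ℕ} {x : ℕ → ℝ} {s : Set ℝ} (hs : IsOpen s)
    (h : ∀ i < N, Disjoint s (Set.Ioo (x (2 * i + 1)) (x (2 * i + 2)))) {y : ℝ} (hy : y ∈ s) :
    y ∉ closure (resonators N x) := by
  have : Disjoint s (resonators N x) := by
    refine Set.disjoint_iUnion₂_right.2 fun i hi => ?_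
    have := h (i - 1) (by have := hi.1; have := hi.2; omega)
    rwa [show 2 * (i - 1) + 1 = 2 * i - 1 by have := hi.1; omega,
      show 2 * (i - 1) + 2 = 2 * i by have := hi.1; omega] at this
  exact fun h' => Set.disjoint_left.1 (this.closure_right hs) hy h'

section

variable {N : ℕ} {x : ℕ → ℝ} {δ k : ℂ} {u : ℝ → ℂ}

lemma disjoint_spacing (hx : StrictMonoOn x (Set.Icc 1 (2 * N))) {i j : ℕ} (hi : i + 1 < N)
    (hj : j < N) : Disjoint (Set.Ioo (x (2 * i + 2)) (x (2 * i + 3)))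
      (Set.Ioo (x (2 * j + 1)) (x (2 * j + 2))) := by
  refine Set.disjoint_left.2 fun y hy hy' => ?_
  rcases le_or_gt j i with h | h
  · have : x (2 * j + 2) ≤ x (2 * i + 2) := hx.monotoneOn
      ⟨by omega, by omega⟩ ⟨by omega, by omega⟩ (by omega)
    linarith [hy.1, hy'.2]
  · have : x (2 * i + 3) ≤ x (2 * j + 1) := hx.monotoneOn
      ⟨by omega, by omega⟩ ⟨by omega, by omega⟩ (by omega)
    linarith [hy.2, hy'.1]

lemma notMem_closure_of_lt (hx : StrictMonoOn x (Set.Icc 1 (2 * N))) {y : ℝ} (hy : y < x 1) :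
    y ∉ closure (resonators N x) := by
  refine notMem_closure_resonators isOpen_Iio (fun i hi => ?_) (Set.mem_Iio.2 hy)
  refine Set.disjoint_left.2 fun z hz hz' => ?_
  have : x 1 ≤ x (2 * i + 1) := hx.monotoneOn
    ⟨by omega, by omega⟩ ⟨by omega, by omega⟩ (by omega)
  linarith [Set.mem_Iio.1 hz, hz'.1]

lemma notMem_closure_of_gt (hx : StrictMonoOn x (Set.Icc 1 (2 * N))) {y : ℝ}
    (hy : x (2 * N) < y) : y ∉ closure (resonators N x) := by
  refine notMem_closure_resonators isOpen_Ioi (fun i hi => ?_) (Set.mem_Ioi.2 hy)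
  refine Set.disjoint_left.2 fun z hz hz' => ?_
  have : x (2 * i + 2) ≤ x (2 * N) := hx.monotoneOn
    ⟨by omega, by omega⟩ ⟨by omega, by omega⟩ (by omega)
  linarith [Set.mem_Ioi.1 hz, hz'.2]

theorem IsEigenmode.exists_hasOuterDerivs (hx : StrictMonoOn x (Set.Icc 1 (2 * N))) (hN : 0 < N)
    (h : IsEigenmode N x 1 δ k u) : ∃ D, HasOuterDerivs N x δ k u D := by
  have hex : ∀ n, ∃ d : ℂ, 1 ≤ n → n ≤ 2 * N →
      (n % 2 = 1 → Tendsto (deriv u) (𝓝[<] (x n)) (𝓝 d) ∧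
        Tendsto (deriv u) (𝓝[>] (x n)) (𝓝 (δ * d))) ∧
      (n % 2 = 0 → Tendsto (deriv u) (𝓝[>] (x n)) (𝓝 d) ∧
        Tendsto (deriv u) (𝓝[<] (x n)) (𝓝 (δ * d))) := by
    intro n
    by_cases hn : 1 ≤ n ∧ n ≤ 2 * N
    · rcases Nat.mod_two_eq_zero_or_one n with h0 | h1
      · obtain ⟨d, hd⟩ := h.jump_right (n / 2) ⟨by omega, by omega⟩
        rw [show 2 * (n / 2) = n by omega] at hd
        exact ⟨d, fun _ _ => ⟨fun h' => by omega, fun _ => hd⟩⟩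
      · obtain ⟨d, hd⟩ := h.jump_left ((n + 1) / 2) ⟨by omega, by omega⟩
        rw [show 2 * ((n + 1) / 2) - 1 = n by omega] at hd
        exact ⟨d, fun _ _ => ⟨fun _ => hd, fun h' => by omega⟩⟩
    · exact ⟨0, fun h1 h2 => absurd ⟨h1, h2⟩ hn⟩
  choose D hD using hex
  have hL : ∀ i < N, _ := fun i hi =>
    (hD (2 * i + 1) (by omega) (by omega)).1 (by omega)
  have hR : ∀ i < N, _ := fun i hi =>
    (hD (2 * i + 2) (by omega) (by omega)).2 (by omega)
  have hres : ∀ i (hi : i < N), _ := fun i hi =>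
    helmholtz_interval (k := k) (hx ⟨by omega, by omega⟩ ⟨by omega, by omega⟩
      (show 2 * i + 1 < 2 * i + 2 by omega)) h.continuous
      (fun y hy => by
        have := h.helmholtz_inside y (Set.mem_iUnion₂.2 ⟨i + 1, ⟨by omega, by omega⟩, hy⟩)
        simpa using this) (hL i hi).2 (hR i hi).2
  have hspa : ∀ i (hi : i + 1 < N), _ := fun i hi =>
    helmholtz_interval (k := k) (hx ⟨by omega, by omega⟩ ⟨by omega, by omega⟩
      (show 2 * i + 2 < 2 * (i + 1) + 1 by omega)) h.continuous
      (fun y hy => h.helmholtz_outside y (notMem_closure_resonators isOpen_Ioo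
        (fun j hj => disjoint_spacing hx hi hj) hy)) (hR i (by omega)).1 (hL (i + 1) hi).1
  refine ⟨D, fun i hi => (hres i hi).1, fun i hi => ?_, fun i hi => (hspa i hi).1,
    fun i hi => ?_, ?_, ?_⟩
  · rw [t_one]; exact (hres i hi).2
  · rw [t_one]; exact (hspa i hi).2
  · refine tendsto_nhds_unique (hL 0 hN).1 (Tendsto.congr' (f₁ := fun y : ℝ =>
      -(Complex.I * k * u y)) ?_ ?_)
    · filter_upwards [self_mem_nhdsWithin] with y hy
      linear_combination h.radiation_left y hy
    · have := h.continuous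
      exact Tendsto.mono_left (Continuous.tendsto (by fun_prop) _) nhdsWithin_le_nhds
  · have h1 := (hD (2 * N) (by omega) le_rfl).2 (by omega)
    refine tendsto_nhds_unique h1.1 (Tendsto.congr' (f₁ := fun y : ℝ =>
      Complex.I * k * u y) ?_ ?_)
    · filter_upwards [self_mem_nhdsWithin] with y hy
      linear_combination -h.radiation_right y hy
    · have := h.continuous
      exact Tendsto.mono_left (Continuous.tendsto (by fun_prop) _) nhdsWithin_le_nhds

theorem IsEigenmode.exists_outerDeriv_ne_zero (hx : StrictMonoOn x (Set.Icc 1 (2 * N)))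
    (hN : 0 < N) (hk : k ≠ 0) (h : IsEigenmode N x 1 δ k u) {D : ℕ → ℂ}
    (hD : HasOuterDerivs N x δ k u D) : ∃ j, 1 ≤ j ∧ j ≤ 2 * N ∧ D j ≠ 0 := by
  by_contra! hD0
  have hle : ∀ j, 1 ≤ j → j < 2 * N → x j ≤ x (j + 1) := fun j h1 h2 =>
    (hx ⟨h1, by omega⟩ ⟨by omega, by omega⟩ (Nat.lt_succ_self j)).le
  have hres : ∀ i < N, u (x (2 * i + 1)) = 0 →
      ∀ y ∈ Set.Icc (x (2 * i + 1)) (x (2 * i + 2)), u y = 0 := by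
    intro i hi h0 y hy
    have := hD.resonator i hi y hy
    rw [h0, hD0 (2 * i + 1) (by omega) (by omega)] at this
    simpa [hk] using this
  have hspa : ∀ i, i + 1 < N → u (x (2 * i + 2)) = 0 →
      ∀ y ∈ Set.Icc (x (2 * i + 2)) (x (2 * i + 3)), u y = 0 := by
    intro i hi h0 y hy
    have := hD.spacing i hi y hy
    rw [h0, hD0 (2 * i + 2) (by omega) (by omega)] at this
    simpa [hk] using this
  have hleft : ∀ i < N, u (x (2 * i + 1)) = 0 := by
    intro i
    induction i with
    | zero =>
      intro _
      have := hD.left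
      rw [hD0 1 le_rfl (by omega)] at this
      simpa [hk] using this
    | succ i ih =>
      intro hi
      have h1 := hres i (by omega) (ih (by omega)) _
        (Set.right_mem_Icc.2 (hle (2 * i + 1) (by omega) (by omega)))
      exact hspa i hi h1 _ (Set.right_mem_Icc.2 (hle (2 * i + 2) (by omega) (by omega)))
  have hright : ∀ i < N, u (x (2 * i + 2)) = 0 := fun i hi =>
    hres i hi (hleft i hi) _ (Set.right_mem_Icc.2 (hle (2 * i + 1) (by omega) (by omega)))
  obtain ⟨y, hy⟩ := h.nontrivial
  apply hy
  have h2N : u (x (2 * N)) = 0 := by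
    have := hright (N - 1) (by omega)
    rwa [show 2 * (N - 1) + 2 = 2 * N by omega] at this
  rcases lt_or_ge y (x 1) with hy1 | hy1
  · refine eq_zero_of_deriv_eq_mul (p := y - 1) (q := x 1) (z := x 1) (m := -(Complex.I * k))
      h.continuous (hleft 0 hN) (l := 𝓝[<] x 1) (Ioo_mem_nhdsLT (by linarith))
      nhdsWithin_le_nhds (fun w hw => ⟨(h.helmholtz_outside w (notMem_closure_of_lt hx hw.2)).1,
        by linear_combination -h.radiation_left w hw.2⟩) ⟨by linarith, hy1⟩
  rcases lt_or_ge (x (2 * N)) y with hy2 | hy2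
  · refine eq_zero_of_deriv_eq_mul (p := x (2 * N)) (q := y + 1) (z := x (2 * N))
      (m := Complex.I * k) h.continuous h2N (l := 𝓝[>] x (2 * N)) (Ioo_mem_nhdsGT (by linarith))
      nhdsWithin_le_nhds (fun w hw => ⟨(h.helmholtz_outside w (notMem_closure_of_gt hx hw.1)).1,
        by linear_combination h.radiation_right w hw.1⟩) ⟨hy2, by linarith⟩
  -- The largest end point to the left of `y` determines the interval that contains `y`.
  have hfind : ∀ n, n < 2 * N → y ≤ x (n + 1) → u y = 0 := by
    intro n
    induction n with
    | zero => exact fun _ hn => by rw [le_antisymm hn hy1]; exact hleft 0 hN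
    | succ n ih =>
      intro h1 h2
      rcases le_or_gt y (x (n + 1)) with h3 | h3
      · exact ih (by omega) h3
      · rcases Nat.even_or_odd' n with ⟨m, rfl | rfl⟩
        · exact hres m (by omega) (hleft m (by omega)) y ⟨h3.le, h2⟩
        · exact hspa m (by omega) (hright m (by omega)) y ⟨h3.le, h2⟩
  refine hfind (2 * N - 1) (by omega) ?_
  rwa [show 2 * N - 1 + 1 = 2 * N by omega]

end

/-! ### Orders of magnitude -/

/-- `f` is of the order `κ ^ n` along the filter `l`. -/
def IsOrder {ι : Type*} (l : Filter ι) (κ : ι → ℂ) (n : ℕ) (f : ι → ℂ) : Prop :=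
  f =O[l] fun s => κ s ^ n

section Order

variable {ι : Type*} {l : Filter ι} {κ : ι → ℂ} {m n : ℕ} {f g : ι → ℂ}

lemma IsOrder.add (hf : IsOrder l κ n f) (hg : IsOrder l κ n g) :
    IsOrder l κ n fun s => f s + g s := Asymptotics.IsBigO.add hf hg

lemma IsOrder.sub (hf : IsOrder l κ n f) (hg : IsOrder l κ n g) :
    IsOrder l κ n fun s => f s - g s := Asymptotics.IsBigO.sub hf hg

lemma IsOrder.mul (hf : IsOrder l κ m f) (hg : IsOrder l κ n g) :
    IsOrder l κ (m + n) fun s => f s * g s := by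
  unfold IsOrder
  simp_rw [pow_add]
  exact Asymptotics.IsBigO.mul hf hg

lemma IsOrder.const_mul (hf : IsOrder l κ n f) (c : ℂ) : IsOrder l κ n fun s => c * f s :=
  Asymptotics.IsBigO.const_mul_left hf c

lemma IsOrder.congr (hf : IsOrder l κ n f) (h : ∀ s, f s = g s) : IsOrder l κ n g :=
  Asymptotics.IsBigO.congr_left hf h

lemma IsOrder.sum {α : Type*} {t : Finset α} {F : α → ι → ℂ}
    (h : ∀ i ∈ t, IsOrder l κ n (F i)) : IsOrder l κ n fun s => ∑ i ∈ t, F i s :=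
  Asymptotics.IsBigO.fun_sum h

lemma IsOrder.of_tendsto {c : ℂ} (h : Tendsto f l (𝓝 c)) : IsOrder l κ 0 f := by
  unfold IsOrder
  simpa using h.isBigO_one ℂ

lemma IsOrder.const (c : ℂ) : IsOrder l κ 0 fun _ => c := .of_tendsto tendsto_const_nhds

lemma IsOrder.pow_self : IsOrder l κ n fun s => κ s ^ n := Asymptotics.isBigO_refl _ _

lemma IsOrder.mono (hκ : Tendsto κ l (𝓝 0)) (hmn : n ≤ m) (hf : IsOrder l κ m f) :
    IsOrder l κ n f := by
  obtain ⟨d, rfl⟩ := Nat.exists_eq_add_of_le hmn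
  refine Asymptotics.IsBigO.trans hf ?_
  have h1 : (fun s => κ s ^ d) =O[l] fun _ => (1 : ℂ) := (hκ.pow d).isBigO_one ℂ
  simpa [pow_add] using (Asymptotics.isBigO_refl (fun s => κ s ^ n) l).mul h1

lemma IsOrder.div_pow (hκ0 : ∀ s, κ s ≠ 0) (hf : IsOrder l κ (n + m) f) :
    IsOrder l κ n fun s => f s / κ s ^ m := by
  have h := Asymptotics.IsBigO.mul hf (Asymptotics.isBigO_refl (fun s => (κ s ^ m)⁻¹) l)
  refine (h.congr_left fun s => by rw [div_eq_mul_inv]).congr_right fun s => ?_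
  rw [pow_add, mul_inv_cancel_right₀ (pow_ne_zero _ (hκ0 s))]

lemma IsOrder.tendsto_zero (hκ : Tendsto κ l (𝓝 0)) (hf : IsOrder l κ 1 f) :
    Tendsto f l (𝓝 0) := Asymptotics.IsBigO.trans_tendsto hf (by simpa using hκ)

lemma IsOrder.comp_continuous (hf : IsOrder l κ 0 f) {φ : ℂ → ℂ} (hφ : Continuous φ) :
    IsOrder l κ 0 fun s => φ (f s) := by
  unfold IsOrder at hf ⊢
  simp only [pow_zero] at hf ⊢
  obtain ⟨C, hC⟩ := hf.bound
  obtain ⟨B, hB⟩ := (isCompact_closedBall (0 : ℂ) C).exists_bound_of_continuousOn hφ.continuousOn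
  refine Asymptotics.IsBigO.of_bound B ?_
  filter_upwards [hC] with s hs
  simpa using hB (f s) (by simpa using hs)

/-- Composition with a function that is differentiable at `0`. -/
lemma IsOrder.comp_sub {φ : ℂ → ℂ} {φ' : ℂ} (hφ : HasDerivAt φ φ' 0)
    (hκ : Tendsto κ l (𝓝 0)) (hf : IsOrder l κ 1 f) : IsOrder l κ 1 fun s => φ (f s) - φ 0 := by
  have := hφ.isBigO_sub.comp_tendsto (hf.tendsto_zero hκ)
  exact Asymptotics.IsBigO.trans (by simpa [Function.comp_def] using this) hf

lemma norm_sin_sub_self_le {z : ℂ} (hz : ‖z‖ ≤ 1) : ‖Complex.sin z - z‖ ≤ ‖z‖ ^ 2 := by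
  have h1 := Complex.norm_exp_sub_one_sub_id_le (x := z * Complex.I) (by simpa using hz)
  have h2 := Complex.norm_exp_sub_one_sub_id_le (x := -z * Complex.I) (by simpa using hz)
  have e : Complex.sin z - z = ((Complex.exp (-z * Complex.I) - 1 - -z * Complex.I) -
      (Complex.exp (z * Complex.I) - 1 - z * Complex.I)) * Complex.I / 2 := by
    rw [Complex.sin]
    linear_combination (-z) * Complex.I_mul_I
  rw [e, norm_div, norm_mul, Complex.norm_I, mul_one]
  have h3 := norm_sub_le (Complex.exp (-z * Complex.I) - 1 - -z * Complex.I)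
    (Complex.exp (z * Complex.I) - 1 - z * Complex.I)
  simp only [norm_mul, norm_neg, Complex.norm_I, mul_one] at h1 h2
  rw [Complex.norm_ofNat, div_le_iff₀ (by norm_num)]
  linarith

lemma IsOrder.sin_sub_self (hκ : Tendsto κ l (𝓝 0)) (hf : IsOrder l κ 1 f) :
    IsOrder l κ 2 fun s => Complex.sin (f s) - f s := by
  refine Asymptotics.IsBigO.trans (g := fun s => f s * f s) ?_ (hf.mul hf)
  refine Asymptotics.IsBigO.of_bound 1 ?_
  have := (hf.tendsto_zero hκ).norm
  rw [norm_zero] at this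
  filter_upwards [this.eventually_le_const one_pos] with s hs
  rw [one_mul, norm_mul, ← sq]
  exact norm_sin_sub_self_le hs

end Order

/-! ### Trigonometric factors near a real wave number -/

section Trig

variable {ι : Type*} {l : Filter ι} {κ k : ι → ℂ} {k₀ : ℝ}

lemma isOrder_sub_ofReal (hκ : Tendsto κ l (𝓝 0))
    (hk : IsOrder l κ 2 fun s => k s - (k₀ + κ s)) : IsOrder l κ 1 fun s => k s - k₀ :=
  ((hk.mono hκ one_le_two).add (.pow_self (n := 1))).congr fun s => by ring

lemma tendsto_ofReal_of_isOrder (hκ : Tendsto κ l (𝓝 0))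
    (hk : IsOrder l κ 2 fun s => k s - (k₀ + κ s)) : Tendsto k l (𝓝 k₀) := by
  simpa using ((isOrder_sub_ofReal hκ hk).tendsto_zero hκ).add_const (k₀ : ℂ)

lemma isOrder_inv (hk₀ : k₀ ≠ 0) (hκ : Tendsto κ l (𝓝 0))
    (hk : IsOrder l κ 2 fun s => k s - (k₀ + κ s)) : IsOrder l κ 0 fun s => (k s)⁻¹ :=
  .of_tendsto ((tendsto_ofReal_of_isOrder hκ hk).inv₀ (by exact_mod_cast hk₀))

lemma isOrder_inv_sub (hk₀ : k₀ ≠ 0) (hκ : Tendsto κ l (𝓝 0)) (hkne : ∀ s, k s ≠ 0)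
    (hk : IsOrder l κ 2 fun s => k s - (k₀ + κ s)) :
    IsOrder l κ 1 fun s => (k s)⁻¹ - (k₀ : ℂ)⁻¹ := by
  refine (((isOrder_sub_ofReal hκ hk).mul (isOrder_inv hk₀ hκ hk)).const_mul
    (-(k₀ : ℂ)⁻¹)).congr fun s => ?_
  have h0 : (k₀ : ℂ) ≠ 0 := by exact_mod_cast hk₀
  have := hkne s
  field_simp
  ring

lemma isOrder_mul_ofReal (hκ : Tendsto κ l (𝓝 0))
    (hk : IsOrder l κ 2 fun s => k s - (k₀ + κ s)) {τ : ι → ℝ}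
    (hτ : IsOrder l κ 0 fun s => (τ s : ℂ)) : IsOrder l κ 0 fun s => k s * τ s :=
  IsOrder.mul (m := 0) (.of_tendsto (tendsto_ofReal_of_isOrder hκ hk)) hτ

lemma isOrder_sin (hκ : Tendsto κ l (𝓝 0))
    (hk : IsOrder l κ 2 fun s => k s - (k₀ + κ s)) {τ : ι → ℝ}
    (hτ : IsOrder l κ 0 fun s => (τ s : ℂ)) :
    IsOrder l κ 0 fun s => Complex.sin (k s * τ s) :=
  (isOrder_mul_ofReal hκ hk hτ).comp_continuous Complex.continuous_sin

lemma isOrder_cos (hκ : Tendsto κ l (𝓝 0))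
    (hk : IsOrder l κ 2 fun s => k s - (k₀ + κ s)) {τ : ι → ℝ}
    (hτ : IsOrder l κ 0 fun s => (τ s : ℂ)) :
    IsOrder l κ 0 fun s => Complex.cos (k s * τ s) :=
  (isOrder_mul_ofReal hκ hk hτ).comp_continuous Complex.continuous_cos

lemma isOrder_sin_sub_sin (hκ : Tendsto κ l (𝓝 0))
    (hk : IsOrder l κ 2 fun s => k s - (k₀ + κ s)) {τ : ι → ℝ}
    (hτ : IsOrder l κ 0 fun s => (τ s : ℂ)) :
    IsOrder l κ 1 fun s => Complex.sin (k s * τ s) - Complex.sin (k₀ * τ s) := by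
  have h1 : IsOrder l κ 1 fun s => (k s - k₀) * τ s := (isOrder_sub_ofReal hκ hk).mul hτ
  have h2 : IsOrder l κ 1 fun s => Complex.sin ((k s - k₀) * τ s) :=
    (IsOrder.comp_sub (Complex.hasDerivAt_sin 0) hκ h1).congr fun s => by simp
  have h3 : IsOrder l κ 1 fun s => Complex.cos ((k s - k₀) * τ s) - 1 :=
    (IsOrder.comp_sub (Complex.hasDerivAt_cos 0) hκ h1).congr fun s => by simp
  have h0 : IsOrder l κ 0 fun s => (k₀ : ℂ) * τ s := hτ.const_mul _
  refine ((h2.mul (h0.comp_continuous Complex.continuous_cos)).add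
    (h3.mul (h0.comp_continuous Complex.continuous_sin))).congr fun s => ?_
  rw [show k s * τ s = (k s - k₀) * τ s + k₀ * τ s by ring, Complex.sin_add]
  ring

variable {τ η : ℝ}

lemma isOrder_cos_sub (hκ : Tendsto κ l (𝓝 0))
    (hk : IsOrder l κ 2 fun s => k s - (k₀ + κ s)) (hsin : Real.sin (k₀ * τ) = 0)
    (hcos : Real.cos (k₀ * τ) = η) :
    IsOrder l κ 1 fun s => Complex.cos (k s * τ) - η := by
  have h1 : IsOrder l κ 1 fun s => (k s - k₀) * τ := (isOrder_sub_ofReal hκ hk).mul (.const _)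
  refine ((IsOrder.comp_sub (Complex.hasDerivAt_cos 0) hκ h1).const_mul η).congr fun s => ?_
  rw [show k s * τ = (k₀ * τ : ℝ) + (k s - k₀) * τ by push_cast; ring, Complex.cos_add,
    ← Complex.ofReal_cos, ← Complex.ofReal_sin, hsin, hcos]
  simp; ring

/-- At a resonance `sin (k₀ τ) = 0` the sine grows linearly in `κ`. -/
lemma isOrder_sin_sub (hκ : Tendsto κ l (𝓝 0))
    (hk : IsOrder l κ 2 fun s => k s - (k₀ + κ s)) (hsin : Real.sin (k₀ * τ) = 0)
    (hcos : Real.cos (k₀ * τ) = η) :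
    IsOrder l κ 2 fun s => Complex.sin (k s * τ) - η * κ s * τ := by
  have h1 : IsOrder l κ 1 fun s => (k s - k₀) * τ := (isOrder_sub_ofReal hκ hk).mul (.const _)
  refine (((h1.sin_sub_self hκ).add (hk.const_mul τ)).const_mul η).congr fun s => ?_
  rw [show k s * τ = (k₀ * τ : ℝ) + (k s - k₀) * τ by push_cast; ring, Complex.sin_add,
    ← Complex.ofReal_cos, ← Complex.ofReal_sin, hsin, hcos]
  simp; ring

lemma IsOrder.of_mul_sin {n : ℕ} {f : ι → ℂ}
    (h : IsOrder l κ n fun s => f s * Complex.sin (k s * τ)) (hκ : Tendsto κ l (𝓝 0))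
    (hk : IsOrder l κ 2 fun s => k s - (k₀ + κ s)) (hsin : Real.sin (k₀ * τ) ≠ 0) :
    IsOrder l κ n f := by
  have hne : Complex.sin (k₀ * τ) ≠ 0 := by exact_mod_cast hsin
  have ht : Tendsto (fun s => Complex.sin (k s * τ)) l (𝓝 (Complex.sin (k₀ * τ))) :=
    (Complex.continuous_sin.tendsto _).comp ((tendsto_ofReal_of_isOrder hκ hk).mul_const _)
  refine Asymptotics.IsBigO.congr' (h.mul (n := 0) (.of_tendsto (ht.inv₀ hne))) ?_ .rfl
  filter_upwards [ht.eventually_ne hne] with s hs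
  rw [mul_inv_cancel_right₀ hs]

lemma IsOrder.of_mul_sin_of_eq_zero {n : ℕ} {f : ι → ℂ}
    (h : IsOrder l κ (n + 1) fun s => f s * Complex.sin (k s * τ)) (hκ : Tendsto κ l (𝓝 0))
    (hκ0 : ∀ s, κ s ≠ 0) (hk : IsOrder l κ 2 fun s => k s - (k₀ + κ s)) (hτ : τ ≠ 0)
    (hsin : Real.sin (k₀ * τ) = 0) : IsOrder l κ n f := by
  have hη : Real.cos (k₀ * τ) ≠ 0 := fun h0 => by
    have := Real.sin_sq_add_cos_sq (k₀ * τ)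
    rw [hsin, h0] at this
    norm_num at this
  have hne : (Real.cos (k₀ * τ) : ℂ) * τ ≠ 0 := by exact_mod_cast mul_ne_zero hη hτ
  have ht : Tendsto (fun s => Complex.sin (k s * τ) / κ s) l (𝓝 (Real.cos (k₀ * τ) * τ)) := by
    have h1 := ((isOrder_sin_sub hκ hk hsin rfl).div_pow (n := 1) (m := 1) hκ0).tendsto_zero hκ
    have h2 := h1.add_const ((Real.cos (k₀ * τ) : ℂ) * τ)
    rw [zero_add] at h2
    refine h2.congr fun s => ?_
    have := hκ0 s
    field_simp
    ring
  refine Asymptotics.IsBigO.congr'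
    ((h.div_pow (m := 1) hκ0).mul (n := 0) (.of_tendsto (ht.inv₀ hne))) ?_ .rfl
  filter_upwards [ht.eventually_ne hne] with s hs
  rw [pow_one, mul_div_assoc, mul_inv_cancel_right₀ hs]

end Trig

/-! ### The gauge -/

open Classical in
/-- The sign `cos (k₀ t_j) = ±1` of a resonant index, and `1` for all other indices. -/
noncomputable def resSign (N : ℕ) (x : ℕ → ℝ) (k₀ : ℝ) (j : ℕ) : ℝ :=
  if IsResonantIndex N x 1 k₀ j then Real.cos (k₀ * t x 1 j) else 1

/-- The product of the signs of the resonant indices below `n`. It removes the signs from the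
leading-order transfer equations. -/
noncomputable def gauge (N : ℕ) (x : ℕ → ℝ) (k₀ : ℝ) (n : ℕ) : ℝ :=
  ∏ j ∈ Finset.range n, resSign N x k₀ j

section Gauge

variable {N : ℕ} {x : ℕ → ℝ} {k₀ : ℝ}

lemma IsResonantIndex.sin_eq_zero {j : ℕ} (h : IsResonantIndex N x 1 k₀ j) :
    Real.sin (k₀ * t x 1 j) = 0 := by
  obtain ⟨-, -, m, hm⟩ := h
  rw [mul_comm, hm, Real.sin_int_mul_pi]

lemma sin_ne_zero_of_not_isResonantIndex {j : ℕ} (h1 : 1 ≤ j) (h2 : j ≤ 2 * N - 1)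
    (h : ¬ IsResonantIndex N x 1 k₀ j) : Real.sin (k₀ * t x 1 j) ≠ 0 := by
  intro h0
  obtain ⟨m, hm⟩ := Real.sin_eq_zero_iff.1 h0
  exact h ⟨h1, h2, m, by rw [hm, mul_comm]⟩

lemma resSign_mul_self (j : ℕ) : resSign N x k₀ j * resSign N x k₀ j = 1 := by
  unfold resSign
  split_ifs with h
  · have := Real.sin_sq_add_cos_sq (k₀ * t x 1 j)
    rw [h.sin_eq_zero] at this
    linarith
  · norm_num

lemma gauge_succ (n : ℕ) : gauge N x k₀ (n + 1) = gauge N x k₀ n * resSign N x k₀ n :=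
  Finset.prod_range_succ _ _

lemma gauge_mul_self (n : ℕ) : gauge N x k₀ n * gauge N x k₀ n = 1 := by
  simp_rw [gauge, ← Finset.prod_mul_distrib, resSign_mul_self, Finset.prod_const_one]

lemma abs_gauge (n : ℕ) : |gauge N x k₀ n| = 1 := by
  have h := gauge_mul_self (N := N) (x := x) (k₀ := k₀) n
  rcases mul_self_eq_one_iff.1 h with h | h <;> simp [h]

/-- Within a block, the gauge is the value of the cosine with respect to the left end. -/
lemma IsResonantBlock.gauge_mul_gauge {a b : ℕ} (h : IsResonantBlock N x 1 k₀ a b) {n : ℕ}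
    (h1 : a ≤ n) (h2 : n ≤ b + 1) :
    gauge N x k₀ a * gauge N x k₀ n = Real.cos (k₀ * (x n - x a)) ∧
      Real.sin (k₀ * (x n - x a)) = 0 := by
  induction n, h1 using Nat.le_induction with
  | base => simp [gauge_mul_self]
  | succ n hn ih =>
    obtain ⟨e1, e2⟩ := ih (by omega)
    have hres := h.2.2.1 n hn (by omega)
    have hs := hres.sin_eq_zero
    have hc : resSign N x k₀ n = Real.cos (k₀ * t x 1 n) := if_pos hres
    rw [t_one] at hs hc
    rw [gauge_succ, ← mul_assoc, e1, hc,
      show k₀ * (x (n + 1) - x a) = k₀ * (x n - x a) + k₀ * (x (n + 1) - x n) by ring,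
      Real.cos_add, Real.sin_add, e2, hs]
    simp

end Gauge

/-! ### Families of eigenmodes near a resonance -/

/-- A family of eigenmodes `u s`, with outer derivatives `D s` of modulus at most one, whose wave
numbers are `k₀ + κ + O(κ²)` for the contrasts `δ = κ² / lam`, where `κ → 0` along `l`. -/
structure IsResonanceFamily {ι : Type*} (N : ℕ) (x : ℕ → ℝ) (k₀ lam : ℝ) (l : Filter ι)
    (κ k δ : ι → ℂ) (u : ι → ℝ → ℂ) (D : ι → ℕ → ℂ) : Prop where
  strictMono : StrictMonoOn x (Set.Icc 1 (2 * N))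
  k₀_ne : k₀ ≠ 0
  lam_ne : lam ≠ 0
  tendsto : Tendsto κ l (𝓝 0)
  κ_ne : ∀ s, κ s ≠ 0
  k_ne : ∀ s, k s ≠ 0
  isOrder : IsOrder l κ 2 fun s => k s - (k₀ + κ s)
  sq_eq : ∀ s, κ s ^ 2 = lam * δ s
  mode : ∀ s, HasOuterDerivs N x (δ s) (k s) (u s) (D s)
  norm_le : ∀ s j, 1 ≤ j → j ≤ 2 * N → ‖D s j‖ ≤ 1

namespace IsResonanceFamily

variable {ι : Type*} {N : ℕ} {x : ℕ → ℝ} {k₀ lam : ℝ} {l : Filter ι} {κ k δ : ι → ℂ}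
  {u : ι → ℝ → ℂ} {D : ι → ℕ → ℂ}

lemma t_pos (F : IsResonanceFamily N x k₀ lam l κ k δ u D) {j : ℕ} (h1 : 1 ≤ j)
    (h2 : j + 1 ≤ 2 * N) : 0 < t x 1 j := t_one_pos F.strictMono h1 h2

lemma δ_eq (F : IsResonanceFamily N x k₀ lam l κ k δ u D) (s : ι) :
    δ s = (lam : ℂ)⁻¹ * κ s ^ 2 := by
  have : (lam : ℂ) ≠ 0 := by exact_mod_cast F.lam_ne
  rw [F.sq_eq s, inv_mul_cancel_left₀ this]

lemma isOrder_δ (F : IsResonanceFamily N x k₀ lam l κ k δ u D) : IsOrder l κ 2 δ :=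
  ((IsOrder.pow_self (n := 2)).const_mul (lam : ℂ)⁻¹).congr fun s => (F.δ_eq s).symm

lemma isOrder_D (F : IsResonanceFamily N x k₀ lam l κ k δ u D) {j : ℕ} (h1 : 1 ≤ j)
    (h2 : j ≤ 2 * N) : IsOrder l κ 0 fun s => D s j := by
  unfold IsOrder
  simp only [pow_zero]
  exact Asymptotics.IsBigO.of_bound 1 (Eventually.of_forall fun s => by
    simpa using F.norm_le s j h1 h2)

lemma isOrder_k (F : IsResonanceFamily N x k₀ lam l κ k δ u D) : IsOrder l κ 0 k :=
  .of_tendsto (tendsto_ofReal_of_isOrder F.tendsto F.isOrder)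

lemma isOrder_k_inv (F : IsResonanceFamily N x k₀ lam l κ k δ u D) :
    IsOrder l κ 0 fun s => (k s)⁻¹ := isOrder_inv F.k₀_ne F.tendsto F.isOrder

lemma isOrder_sin (F : IsResonanceFamily N x k₀ lam l κ k δ u D) (j : ℕ) :
    IsOrder l κ 0 fun s => Complex.sin (k s * t x 1 j) :=
  ResonatorChain.isOrder_sin F.tendsto F.isOrder (.const _)

lemma isOrder_cos (F : IsResonanceFamily N x k₀ lam l κ k δ u D) (j : ℕ) :
    IsOrder l κ 0 fun s => Complex.cos (k s * t x 1 j) :=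
  ResonatorChain.isOrder_cos F.tendsto F.isOrder (.const _)

lemma isOrder_cos_sub (F : IsResonanceFamily N x k₀ lam l κ k δ u D) {j : ℕ}
    (hj : IsResonantIndex N x 1 k₀ j) :
    IsOrder l κ 1 fun s => Complex.cos (k s * t x 1 j) - resSign N x k₀ j :=
  ResonatorChain.isOrder_cos_sub F.tendsto F.isOrder hj.sin_eq_zero (if_pos hj).symm

lemma isOrder_sin_sub (F : IsResonanceFamily N x k₀ lam l κ k δ u D) {j : ℕ}
    (hj : IsResonantIndex N x 1 k₀ j) :
    IsOrder l κ 2 fun s => Complex.sin (k s * t x 1 j) - resSign N x k₀ j * κ s * t x 1 j :=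
  ResonatorChain.isOrder_sin_sub F.tendsto F.isOrder hj.sin_eq_zero (if_pos hj).symm

lemma isOrder_sin_of_isResonantIndex (F : IsResonanceFamily N x k₀ lam l κ k δ u D) {j : ℕ}
    (hj : IsResonantIndex N x 1 k₀ j) :
    IsOrder l κ 1 fun s => Complex.sin (k s * t x 1 j) :=
  (((F.isOrder_sin_sub hj).mono F.tendsto one_le_two).add
    ((IsOrder.pow_self (n := 1)).const_mul (resSign N x k₀ j * t x 1 j))).congr
    fun s => by ring

lemma resonator_right (F : IsResonanceFamily N x k₀ lam l κ k δ u D) {i : ℕ} (hi : i < N)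
    (s : ι) : u s (x (2 * i + 2)) = u s (x (2 * i + 1)) * Complex.cos (k s * t x 1 (2 * i + 1)) +
      (k s)⁻¹ * δ s * D s (2 * i + 1) * Complex.sin (k s * t x 1 (2 * i + 1)) := by
  have ht := F.t_pos (j := 2 * i + 1) (by omega) (by omega)
  have hk := F.k_ne s
  rw [show t x 1 (2 * i + 1) = x (2 * i + 2) - x (2 * i + 1) from t_one x _] at ht ⊢
  have h := (F.mode s).resonator i hi (x (2 * i + 2)) ⟨by linarith, le_rfl⟩
  field_simp
  linear_combination h

lemma spacing_right (F : IsResonanceFamily N x k₀ lam l κ k δ u D) {i : ℕ} (hi : i + 1 < N)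
    (s : ι) : u s (x (2 * i + 3)) = u s (x (2 * i + 2)) * Complex.cos (k s * t x 1 (2 * i + 2)) +
      (k s)⁻¹ * D s (2 * i + 2) * Complex.sin (k s * t x 1 (2 * i + 2)) := by
  have ht := F.t_pos (j := 2 * i + 2) (by omega) (by omega)
  have hk := F.k_ne s
  rw [show t x 1 (2 * i + 2) = x (2 * i + 3) - x (2 * i + 2) from t_one x _] at ht ⊢
  have h := (F.mode s).spacing i hi (x (2 * i + 3)) ⟨by linarith, le_rfl⟩
  field_simp
  linear_combination h

lemma isOrder_left_mul_sin (F : IsResonanceFamily N x k₀ lam l κ k δ u D) {i : ℕ} (hi : i < N) :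
    IsOrder l κ 2 fun s => u s (x (2 * i + 1)) * Complex.sin (k s * t x 1 (2 * i + 1)) := by
  refine ((F.isOrder_k_inv.mul F.isOrder_δ).mul (((F.isOrder_D (j := 2 * i + 1) (by omega)
    (by omega)).mul (F.isOrder_cos (2 * i + 1))).sub
    (F.isOrder_D (j := 2 * i + 2) (by omega) (by omega)))).congr fun s => ?_
  have hk := F.k_ne s
  field_simp
  linear_combination -(F.mode s).resonator_deriv i hi

/-- At a nonresonant resonator the mode is one order smaller. -/
lemma isOrder_left_of_not_isResonantIndex (F : IsResonanceFamily N x k₀ lam l κ k δ u D) {i : ℕ}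
    (hi : i < N) (h : ¬ IsResonantIndex N x 1 k₀ (2 * i + 1)) :
    IsOrder l κ 2 fun s => u s (x (2 * i + 1)) :=
  (F.isOrder_left_mul_sin hi).of_mul_sin F.tendsto F.isOrder
    (sin_ne_zero_of_not_isResonantIndex (by omega) (by omega) h)

lemma isOrder_left (F : IsResonanceFamily N x k₀ lam l κ k δ u D) {i : ℕ} (hi : i < N) :
    IsOrder l κ 1 fun s => u s (x (2 * i + 1)) := by
  by_cases h : IsResonantIndex N x 1 k₀ (2 * i + 1)
  · exact (F.isOrder_left_mul_sin hi).of_mul_sin_of_eq_zero F.tendsto F.κ_ne F.isOrder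
      (F.t_pos (j := 2 * i + 1) (by omega) (by omega)).ne' h.sin_eq_zero
  · exact (F.isOrder_left_of_not_isResonantIndex hi h).mono F.tendsto one_le_two

lemma isOrder_right_sub (F : IsResonanceFamily N x k₀ lam l κ k δ u D) {i : ℕ} (hi : i < N) :
    IsOrder l κ 2 fun s => u s (x (2 * i + 2)) -
      resSign N x k₀ (2 * i + 1) * u s (x (2 * i + 1)) := by
  have h1 := ((F.isOrder_k_inv.mul F.isOrder_δ).mul
    (F.isOrder_D (j := 2 * i + 1) (by omega) (by omega))).mul (F.isOrder_sin (2 * i + 1))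
  by_cases h : IsResonantIndex N x 1 k₀ (2 * i + 1)
  · refine (((F.isOrder_left hi).mul (F.isOrder_cos_sub h)).add h1).congr fun s => ?_
    rw [F.resonator_right hi]; ring
  · have h2 := F.isOrder_left_of_not_isResonantIndex hi h
    refine (((h2.mul (F.isOrder_cos (2 * i + 1))).add h1).sub
      (h2.const_mul (resSign N x k₀ (2 * i + 1)))).congr fun s => ?_
    rw [F.resonator_right hi]

lemma isOrder_right (F : IsResonanceFamily N x k₀ lam l κ k δ u D) {i : ℕ} (hi : i < N) :
    IsOrder l κ 1 fun s => u s (x (2 * i + 2)) :=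
  (((F.isOrder_right_sub hi).mono F.tendsto one_le_two).add
    ((F.isOrder_left hi).const_mul (resSign N x k₀ (2 * i + 1)))).congr fun s => by ring

/-- Leading-order balance of the derivatives at the two ends of a resonant resonator. -/
lemma isOrder_resonator_balance (F : IsResonanceFamily N x k₀ lam l κ k δ u D) {i : ℕ}
    (hi : i < N) (h : IsResonantIndex N x 1 k₀ (2 * i + 1)) :
    IsOrder l κ 3 fun s =>
      lam * k₀ * resSign N x k₀ (2 * i + 1) * t x 1 (2 * i + 1) * κ s * u s (x (2 * i + 1)) -
      κ s ^ 2 * (D s (2 * i + 1) * resSign N x k₀ (2 * i + 1) - D s (2 * i + 2)) := by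
  have h1 : IsOrder l κ 2 fun s =>
      k₀ * (resSign N x k₀ (2 * i + 1) * κ s * t x 1 (2 * i + 1)) -
        k s * Complex.sin (k s * t x 1 (2 * i + 1)) :=
    (((F.isOrder_sin_sub h).const_mul (-k₀)).sub
      ((isOrder_sub_ofReal F.tendsto F.isOrder).mul
        (F.isOrder_sin_of_isResonantIndex h))).congr fun s => by ring
  have h2 := (h1.mul (F.isOrder_left hi)).const_mul lam
  have h3 := ((IsOrder.pow_self (l := l) (κ := κ) (n := 2)).mul
    (F.isOrder_D (j := 2 * i + 1) (by omega) (by omega))).mul (F.isOrder_cos_sub h)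
  refine (h2.add h3).congr fun s => ?_
  have h4 := (F.mode s).resonator_deriv i hi
  linear_combination (D s (2 * i + 1) * Complex.cos (k s * t x 1 (2 * i + 1)) -
    D s (2 * i + 2)) * F.sq_eq s - lam * h4

/-- Leading-order jump of the values over a resonant spacing. -/
lemma isOrder_spacing_jump (F : IsResonanceFamily N x k₀ lam l κ k δ u D) {i : ℕ}
    (hi : i + 1 < N) (h : IsResonantIndex N x 1 k₀ (2 * i + 2)) :
    IsOrder l κ 2 fun s => u s (x (2 * i + 3)) -
      resSign N x k₀ (2 * i + 2) * u s (x (2 * i + 2)) -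
      (k₀ : ℂ)⁻¹ * resSign N x k₀ (2 * i + 2) * κ s * t x 1 (2 * i + 2) * D s (2 * i + 2) := by
  have h1 : IsOrder l κ 2 fun s => (k s)⁻¹ * Complex.sin (k s * t x 1 (2 * i + 2)) -
      (k₀ : ℂ)⁻¹ * (resSign N x k₀ (2 * i + 2) * κ s * t x 1 (2 * i + 2)) :=
    (((isOrder_inv_sub F.k₀_ne F.tendsto F.k_ne F.isOrder).mul
      (F.isOrder_sin_of_isResonantIndex h)).add
      ((F.isOrder_sin_sub h).const_mul (k₀ : ℂ)⁻¹)).congr fun s => by ring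
  refine (((F.isOrder_right (i := i) (by omega)).mul (F.isOrder_cos_sub h)).add
    (h1.mul (F.isOrder_D (j := 2 * i + 2) (by omega) (by omega)))).congr fun s => ?_
  rw [F.spacing_right hi]; ring

lemma isOrder_spacing_deriv (F : IsResonanceFamily N x k₀ lam l κ k δ u D) {i : ℕ}
    (hi : i + 1 < N) (h : IsResonantIndex N x 1 k₀ (2 * i + 2)) :
    IsOrder l κ 1 fun s => D s (2 * i + 3) - resSign N x k₀ (2 * i + 2) * D s (2 * i + 2) := by
  refine (((F.isOrder_D (j := 2 * i + 2) (by omega) (by omega)).mul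
    (F.isOrder_cos_sub h)).sub ((F.isOrder_k.mul (F.isOrder_right (i := i) (by omega))).mul
    (F.isOrder_sin (2 * i + 2)))).congr fun s => ?_
  rw [(F.mode s).spacing_deriv i hi]; ring

/-- At a nonresonant spacing the derivatives are one order smaller. -/
lemma isOrder_D_of_not_isResonantIndex (F : IsResonanceFamily N x k₀ lam l κ k δ u D) {i : ℕ}
    (hi : i + 1 < N) (h : ¬ IsResonantIndex N x 1 k₀ (2 * i + 2)) :
    IsOrder l κ 1 (fun s => D s (2 * i + 2)) ∧ IsOrder l κ 1 fun s => D s (2 * i + 3) := by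
  have h1 : IsOrder l κ 1 fun s => D s (2 * i + 2) * Complex.sin (k s * t x 1 (2 * i + 2)) := by
    have e1 := F.isOrder_left (i := i + 1) hi
    have e2 := (F.isOrder_right (i := i) (by omega)).mul (F.isOrder_cos (2 * i + 2))
    refine (F.isOrder_k.mul (e1.sub e2)).congr fun s => ?_
    have hk := F.k_ne s
    rw [show 2 * (i + 1) + 1 = 2 * i + 3 by ring, F.spacing_right hi]
    field_simp
    ring
  have h2 := h1.of_mul_sin F.tendsto F.isOrder
    (sin_ne_zero_of_not_isResonantIndex (by omega) (by omega) h)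
  refine ⟨h2, ((h2.mul (F.isOrder_cos (2 * i + 2))).sub ((F.isOrder_k.mul
    (F.isOrder_right (i := i) (by omega))).mul (F.isOrder_sin (2 * i + 2)))).congr fun s => ?_⟩
  rw [(F.mode s).spacing_deriv i hi]

/-! ### The effective eigenvalue problem -/

/-- The rescaled value of a mode at the left end of the resonator `i`. -/
noncomputable def scaledValue (N : ℕ) (x : ℕ → ℝ) (k₀ : ℝ) (κ : ι → ℂ) (u : ι → ℝ → ℂ) (i : ℕ)
    (s : ι) : ℂ :=
  k₀ * gauge N x k₀ (2 * i + 1) * u s (x (2 * i + 1)) / κ s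

local notation "𝔴" => scaledValue N x k₀ κ u

lemma isOrder_resonator (F : IsResonanceFamily N x k₀ lam l κ k δ u D) {i : ℕ} (hi : i < N) :
    IsOrder l κ 1 fun s => lam * 𝔴 i s - invT N x 1 k₀ (2 * i + 1) *
      (gauge N x k₀ (2 * i + 1) * D s (2 * i + 1) -
        gauge N x k₀ (2 * i + 2) * D s (2 * i + 2)) := by
  by_cases h : IsResonantIndex N x 1 k₀ (2 * i + 1)
  · have ht : (t x 1 (2 * i + 1) : ℂ) ≠ 0 := by
      exact_mod_cast (F.t_pos (by omega) (by omega)).ne'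
    have hs : (resSign N x k₀ (2 * i + 1) : ℂ) * resSign N x k₀ (2 * i + 1) = 1 := by
      exact_mod_cast resSign_mul_self (2 * i + 1)
    refine (((F.isOrder_resonator_balance hi h).div_pow (n := 1) (m := 2) F.κ_ne).const_mul
      (gauge N x k₀ (2 * i + 1) * (t x 1 (2 * i + 1) : ℂ)⁻¹ *
        resSign N x k₀ (2 * i + 1))).congr fun s => ?_
    have hκ := F.κ_ne s
    rw [gauge_succ (2 * i + 1), invT_eq h, scaledValue]
    push_cast
    field_simp
    linear_combination gauge N x k₀ (2 * i + 1) * (lam * k₀ * u s (x (2 * i + 1)) *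
      t x 1 (2 * i + 1) - κ s * D s (2 * i + 1)) * hs
  · refine (((F.isOrder_left_of_not_isResonantIndex hi h).div_pow (n := 1) (m := 1)
      F.κ_ne).const_mul (lam * k₀ * gauge N x k₀ (2 * i + 1))).congr fun s => ?_
    rw [invT_eq_zero h, scaledValue]
    push_cast
    ring

lemma isOrder_spacing (F : IsResonanceFamily N x k₀ lam l κ k δ u D) {i : ℕ} (hi : i + 1 < N) :
    IsOrder l κ 1 fun s => gauge N x k₀ (2 * i + 2) * D s (2 * i + 2) -
      invT N x 1 k₀ (2 * i + 2) * (𝔴 (i + 1) s - 𝔴 i s) := by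
  by_cases h : IsResonantIndex N x 1 k₀ (2 * i + 2)
  · have ht : (t x 1 (2 * i + 2) : ℂ) ≠ 0 := by
      exact_mod_cast (F.t_pos (by omega) (by omega)).ne'
    have hk₀ : (k₀ : ℂ) ≠ 0 := by exact_mod_cast F.k₀_ne
    have hs : (resSign N x k₀ (2 * i + 1) : ℂ) * resSign N x k₀ (2 * i + 1) = 1 := by
      exact_mod_cast resSign_mul_self (2 * i + 1)
    have hs' : (resSign N x k₀ (2 * i + 2) : ℂ) * resSign N x k₀ (2 * i + 2) = 1 := by
      exact_mod_cast resSign_mul_self (2 * i + 2)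
    have h1 := (((F.isOrder_spacing_jump hi h).const_mul (resSign N x k₀ (2 * i + 2))).add
      (F.isOrder_right_sub (i := i) (by omega))).div_pow (n := 1) (m := 1) F.κ_ne
    refine (h1.const_mul (-(k₀ * (t x 1 (2 * i + 2) : ℂ)⁻¹ *
      gauge N x k₀ (2 * i + 2)))).congr fun s => ?_
    have hκ := F.κ_ne s
    rw [invT_eq h, scaledValue, scaledValue, show 2 * (i + 1) + 1 = 2 * i + 2 + 1 by ring,
      gauge_succ (2 * i + 2), gauge_succ (2 * i + 1)]
    push_cast
    field_simp
    linear_combination (k₀ * gauge N x k₀ (2 * i + 1) * resSign N x k₀ (2 * i + 1) *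
      u s (x (2 * i + 2)) + gauge N x k₀ (2 * i + 1) * resSign N x k₀ (2 * i + 1) *
      D s (2 * i + 2) * t x 1 (2 * i + 2) * κ s) * hs' +
      k₀ * gauge N x k₀ (2 * i + 1) * u s (x (2 * i + 1)) * hs
  · refine ((F.isOrder_D_of_not_isResonantIndex hi h).1.const_mul
      (gauge N x k₀ (2 * i + 2))).congr fun s => ?_
    rw [invT_eq_zero h]
    push_cast
    ring

lemma isOrder_spacing' (F : IsResonanceFamily N x k₀ lam l κ k δ u D) {i : ℕ} (hi : i + 1 < N) :
    IsOrder l κ 1 fun s => gauge N x k₀ (2 * i + 3) * D s (2 * i + 3) -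
      invT N x 1 k₀ (2 * i + 2) * (𝔴 (i + 1) s - 𝔴 i s) := by
  by_cases h : IsResonantIndex N x 1 k₀ (2 * i + 2)
  · have hs' : (resSign N x k₀ (2 * i + 2) : ℂ) * resSign N x k₀ (2 * i + 2) = 1 := by
      exact_mod_cast resSign_mul_self (2 * i + 2)
    refine ((F.isOrder_spacing hi).add ((F.isOrder_spacing_deriv hi h).const_mul
      (gauge N x k₀ (2 * i + 3)))).congr fun s => ?_
    rw [gauge_succ (2 * i + 2)]
    push_cast
    linear_combination -gauge N x k₀ (2 * i + 2) * D s (2 * i + 2) * hs'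
  · refine ((F.isOrder_D_of_not_isResonantIndex hi h).2.const_mul
      (gauge N x k₀ (2 * i + 3))).congr fun s => ?_
    rw [invT_eq_zero h]
    push_cast
    ring

lemma isOrder_left_deriv (F : IsResonanceFamily N x k₀ lam l κ k δ u D) {i : ℕ} (hi : i < N) :
    IsOrder l κ 1 fun s => gauge N x k₀ (2 * i + 1) * D s (2 * i + 1) -
      invT N x 1 k₀ (2 * i) * (𝔴 i s - 𝔴 (i - 1) s) := by
  rcases Nat.eq_zero_or_pos i with rfl | h0
  · refine ((F.isOrder_k.mul (F.isOrder_left hi)).const_mul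
      (-(gauge N x k₀ 1 * Complex.I))).congr fun s => ?_
    simp only [mul_zero, zero_add, invT_zero, (F.mode s).left]
    push_cast
    ring
  · obtain ⟨i, rfl⟩ := Nat.exists_eq_add_of_le' h0
    exact F.isOrder_spacing' hi

lemma isOrder_right_deriv (F : IsResonanceFamily N x k₀ lam l κ k δ u D) {i : ℕ} (hi : i < N) :
    IsOrder l κ 1 fun s => gauge N x k₀ (2 * i + 2) * D s (2 * i + 2) -
      invT N x 1 k₀ (2 * i + 2) * (𝔴 (i + 1) s - 𝔴 i s) := by
  by_cases h : i + 1 < N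
  · exact F.isOrder_spacing h
  · refine ((F.isOrder_k.mul (F.isOrder_right hi)).const_mul
      (gauge N x k₀ (2 * N) * Complex.I)).congr fun s => ?_
    rw [show 2 * i + 2 = 2 * N by omega, invT_two_mul, (F.mode s).right]
    push_cast
    ring

/-- The rescaled values solve the eigenvalue equation of the capacitance matrix to leading
order. -/
lemma isOrder_capacitance (F : IsResonanceFamily N x k₀ lam l κ k δ u D) (i : Fin N) :
    IsOrder l κ 1 fun s => lam * 𝔴 i s - ∑ j : Fin N, (capacitance N x 1 k₀ i j : ℂ) * 𝔴 j s := by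
  have h1 := F.isOrder_left_deriv i.2
  have h2 := F.isOrder_right_deriv i.2
  refine ((F.isOrder_resonator i.2).add
    ((h1.sub h2).const_mul (invT N x 1 k₀ (2 * i + 1)))).congr fun s => ?_
  have h3 := sum_capacitance_smul N x 1 k₀ (fun i => 𝔴 i s) i
  simp only [Complex.real_smul] at h3
  rw [h3, theta, theta]
  push_cast
  ring

/-- Convergence of the rescaled values and of the derivatives towards an eigenvector. -/
lemma exists_isOrder_sub (F : IsResonanceFamily N x k₀ lam l κ k δ u D) {W : ℕ → ℝ}
    (hline : ∀ v : Fin N → ℝ, (capacitance N x 1 k₀).mulVec v = lam • v →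
      ∃ c : ℝ, v = c • fun i : Fin N => W i) :
    ∃ c : ι → ℂ, ∀ j, 1 ≤ j → j ≤ 2 * N → IsOrder l κ 1 fun s =>
      gauge N x k₀ j * D s j - c s * slope N x 1 k₀ W (2 * (j / 2)) := by
  obtain ⟨G, hG⟩ := exists_pseudoinverse (T := capacitance N x 1 k₀ - lam • 1)
    (w := fun i : Fin N => W i) (fun v hv => hline v (by
      rw [Matrix.sub_mulVec, Matrix.smul_mulVec, Matrix.one_mulVec] at hv
      exact sub_eq_zero.1 hv))
  choose c hc using fun s => hG fun i : Fin N => 𝔴 i s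
  have hw : ∀ i < N, IsOrder l κ 1 fun s => 𝔴 i s - c s * W i := by
    intro i hi
    refine (IsOrder.sum (t := Finset.univ) fun j _ =>
      (F.isOrder_capacitance j).const_mul (-(G ⟨i, hi⟩ j : ℂ))).congr fun s => ?_
    have := hc s ⟨i, hi⟩
    simp only at this
    rw [this]
    refine Finset.sum_congr rfl fun j _ => ?_
    have hT : ∀ m : Fin N, ((capacitance N x 1 k₀ - lam • 1) j m : ℂ) * 𝔴 m s =
        capacitance N x 1 k₀ j m * 𝔴 m s - if j = m then lam * 𝔴 m s else 0 := by
      intro m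
      by_cases h : j = m
      · subst h; simp [sub_mul]
      · simp [h, Matrix.one_apply_ne h]
    simp_rw [hT]
    rw [Finset.sum_sub_distrib, Finset.sum_ite_eq, if_pos (Finset.mem_univ j)]
    ring
  refine ⟨c, fun j h1 h2 => ?_⟩
  rcases Nat.even_or_odd' j with ⟨i, rfl | rfl⟩
  · obtain ⟨i, rfl⟩ := Nat.exists_eq_add_of_le' (show 1 ≤ i by omega)
    have e1 := F.isOrder_right_deriv (i := i) (by omega)
    rw [show 2 * (i + 1) = 2 * i + 2 by ring]
    have e2 : IsOrder l κ 1 fun s => (invT N x 1 k₀ (2 * i + 2) : ℂ) *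
        (𝔴 (i + 1) s - c s * W (i + 1)) := by
      by_cases h : i + 1 < N
      · exact (hw _ h).const_mul _
      · rw [show 2 * i + 2 = 2 * N by omega, invT_two_mul]
        exact ((IsOrder.pow_self (n := 1)).const_mul 0).congr fun s => by simp
    refine ((e1.add e2).sub ((hw i (by omega)).const_mul
      (invT N x 1 k₀ (2 * i + 2)))).congr fun s => ?_
    rw [slope, show 2 * ((2 * i + 2) / 2) = 2 * i + 2 by omega,
      show (2 * i + 2) / 2 = i + 1 by omega, Nat.add_sub_cancel]
    push_cast
    ring
  · have e1 := F.isOrder_left_deriv (i := i) (by omega)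
    refine (e1.add (((hw i (by omega)).sub (hw (i - 1) (by omega))).const_mul
      (invT N x 1 k₀ (2 * i)))).congr fun s => ?_
    rw [slope, show 2 * ((2 * i + 1) / 2) = 2 * i by omega, show 2 * i / 2 = i by omega]
    push_cast
    ring

end IsResonanceFamily

/-- The leading order of a normalized mode on the interval `(x n, x (n + 1))`. -/
noncomputable def leadingProfile (N : ℕ) (x : ℕ → ℝ) (k₀ : ℝ) (W : ℕ → ℝ) (a n : ℕ) (y : ℝ) : ℝ :=
  if n % 2 = 0 then
    gauge N x k₀ a * gauge N x k₀ n * slope N x 1 k₀ W n * Real.sin (k₀ * (y - x n))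
  else 0

namespace IsResonanceFamily

variable {ι : Type*} {N : ℕ} {x : ℕ → ℝ} {k₀ lam : ℝ} {l : Filter ι} {κ k δ : ι → ℂ}
  {u : ι → ℝ → ℂ} {D : ι → ℕ → ℂ}

/-- If the largest outer derivative has modulus one, then the coefficient of the limiting
eigenvector stays away from zero. -/
lemma isOrder_coeff_inv (F : IsResonanceFamily N x k₀ lam l κ k δ u D)
    (hnorm : ∀ s, ∃ j, 1 ≤ j ∧ j ≤ 2 * N ∧ ‖D s j‖ = 1) {Q : ℕ → ℝ} {c : ι → ℂ}
    (hc : ∀ j, 1 ≤ j → j ≤ 2 * N → IsOrder l κ 1 fun s =>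
      gauge N x k₀ j * D s j - c s * Q j) :
    IsOrder l κ 0 (fun s => (c s)⁻¹) ∧ ∀ᶠ s in l, c s ≠ 0 := by
  set B := ∑ j ∈ Finset.Icc 1 (2 * N), |Q j| with hB
  have hsmall : ∀ᶠ s in l, ∀ j ∈ Finset.Icc 1 (2 * N),
      ‖gauge N x k₀ j * D s j - c s * Q j‖ ≤ 1 / 2 := by
    refine (Filter.eventually_all_finset _).2 fun j hj => ?_
    obtain ⟨h1, h2⟩ := Finset.mem_Icc.1 hj
    have := ((hc j h1 h2).tendsto_zero F.tendsto).norm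
    rw [norm_zero] at this
    exact this.eventually_le_const (by norm_num)
  have hlow : ∀ᶠ s in l, 1 / 2 ≤ B * ‖c s‖ := by
    filter_upwards [hsmall] with s hs
    obtain ⟨j, h1, h2, hj⟩ := hnorm s
    have hmem := Finset.mem_Icc.2 ⟨h1, h2⟩
    have e1 := hs j hmem
    have e2 : ‖(gauge N x k₀ j : ℂ) * D s j‖ = 1 := by
      rw [norm_mul, hj, Complex.norm_real, Real.norm_eq_abs, abs_gauge, mul_one]
    have e3 : ‖c s * (Q j : ℂ)‖ ≤ B * ‖c s‖ := by
      rw [norm_mul, Complex.norm_real, Real.norm_eq_abs, mul_comm]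
      exact mul_le_mul_of_nonneg_right
        (Finset.single_le_sum (f := fun j => |Q j|) (fun _ _ => abs_nonneg _) hmem)
        (norm_nonneg _)
    have e4 := norm_sub_norm_le ((gauge N x k₀ j : ℂ) * D s j) (c s * Q j)
    linarith
  have hne : ∀ᶠ s in l, c s ≠ 0 := by
    filter_upwards [hlow] with s hs h0
    rw [h0, norm_zero, mul_zero] at hs
    norm_num at hs
  refine ⟨?_, hne⟩
  unfold IsOrder
  simp only [pow_zero]
  refine Asymptotics.IsBigO.of_bound (2 * B) ?_
  filter_upwards [hlow, hne] with s hs h0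
  have : 0 < ‖c s‖ := norm_pos_iff.2 h0
  rw [norm_inv, norm_one, mul_one, inv_le_iff_one_le_mul₀ this]
  linarith

lemma isOrder_sub_leadingProfile (F : IsResonanceFamily N x k₀ lam l κ k δ u D) {W : ℕ → ℝ}
    {c : ι → ℂ} (hc : ∀ j, 1 ≤ j → j ≤ 2 * N → IsOrder l κ 1 fun s =>
      gauge N x k₀ j * D s j - c s * slope N x 1 k₀ W (2 * (j / 2)))
    (hinv : IsOrder l κ 0 fun s => (c s)⁻¹) (hne : ∀ᶠ s in l, c s ≠ 0) (a : ℕ) {n : ℕ}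
    (h1 : 1 ≤ n) (h2 : n ≤ 2 * N - 1) {y : ι → ℝ} (hy : ∀ s, y s ∈ Set.Icc (x n) (x (n + 1))) :
    IsOrder l κ 1 fun s =>
      k₀ * gauge N x k₀ a / c s * u s (y s) - leadingProfile N x k₀ W a n (y s) := by
  have hk₀ : (k₀ : ℂ) ≠ 0 := by exact_mod_cast F.k₀_ne
  have hτ : IsOrder l κ 0 fun s => ((y s - x n : ℝ) : ℂ) := by
    unfold IsOrder
    simp only [pow_zero]
    refine Asymptotics.IsBigO.of_bound (x (n + 1) - x n) (Eventually.of_forall fun s => ?_)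
    rw [Complex.norm_real, Real.norm_eq_abs, norm_one, mul_one,
      abs_of_nonneg (by linarith [(hy s).1])]
    linarith [(hy s).2]
  have hsin := ResonatorChain.isOrder_sin F.tendsto F.isOrder hτ
  have hcos := ResonatorChain.isOrder_cos F.tendsto F.isOrder hτ
  rcases Nat.even_or_odd' n with ⟨i, rfl | rfl⟩
  · obtain ⟨i, rfl⟩ := Nat.exists_eq_add_of_le' (show 1 ≤ i by omega)
    have hi : i + 1 < N := by omega
    rw [show 2 * (i + 1) = 2 * i + 2 by ring] at *
    have hD := F.isOrder_D (j := 2 * i + 2) (by omega) (by omega)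
    have hd := hc (2 * i + 2) (by omega) (by omega)
    rw [show 2 * ((2 * i + 2) / 2) = 2 * i + 2 by omega] at hd
    have hs0 : IsOrder l κ 0 fun s => Complex.sin (k₀ * ((y s - x (2 * i + 2) : ℝ) : ℂ)) :=
      (hτ.const_mul (k₀ : ℂ)).comp_continuous Complex.continuous_sin
    have e1 := (F.isOrder_right (i := i) (by omega)).mul hcos
    have e2 := ((isOrder_inv_sub F.k₀_ne F.tendsto F.k_ne F.isOrder).mul hD).mul hsin
    have e3 := (hD.mul (isOrder_sin_sub_sin F.tendsto F.isOrder hτ)).const_mul (k₀ : ℂ)⁻¹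
    have e4 := (hd.mul hs0).const_mul ((k₀ : ℂ)⁻¹ * gauge N x k₀ (2 * i + 2))
    have e5 := ((hinv.mul (((e1.add e2).add (e3.mono F.tendsto (by norm_num))).add e4)).const_mul
      (k₀ * gauge N x k₀ a))
    refine Asymptotics.IsBigO.congr' e5 ?_ .rfl
    filter_upwards [hne] with s hs
    have hk := F.k_ne s
    have hg : (gauge N x k₀ (2 * i + 2) : ℂ) * gauge N x k₀ (2 * i + 2) = 1 := by
      exact_mod_cast gauge_mul_self (2 * i + 2)
    have hu : u s (y s) = u s (x (2 * i + 2)) * Complex.cos (k s * (y s - x (2 * i + 2) : ℝ)) +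
        (k s)⁻¹ * D s (2 * i + 2) * Complex.sin (k s * (y s - x (2 * i + 2) : ℝ)) := by
      have := (F.mode s).spacing i hi (y s) (hy s)
      field_simp
      linear_combination this
    rw [hu, leadingProfile, if_pos (by omega)]
    push_cast
    field_simp
    linear_combination (k s * gauge N x k₀ a * D s (2 * i + 2) *
      Complex.sin (k₀ * (y s - x (2 * i + 2)))) * hg
  · have hi : i < N := by omega
    have e1 := (F.isOrder_left hi).mul hcos
    have e2 := ((F.isOrder_k_inv.mul F.isOrder_δ).mul
      (F.isOrder_D (j := 2 * i + 1) (by omega) (by omega))).mul hsin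
    refine ((hinv.mul (e1.add (e2.mono F.tendsto (by norm_num)))).const_mul
      (k₀ * gauge N x k₀ a)).congr fun s => ?_
    have hk := F.k_ne s
    have hu : u s (y s) = u s (x (2 * i + 1)) * Complex.cos (k s * (y s - x (2 * i + 1) : ℝ)) +
        (k s)⁻¹ * δ s * D s (2 * i + 1) * Complex.sin (k s * (y s - x (2 * i + 1) : ℝ)) := by
      have := (F.mode s).resonator i hi (y s) (hy s)
      field_simp
      linear_combination this
    rw [hu, leadingProfile, if_neg (by omega)]
    push_cast
    ring

/-- The estimate is uniform on each interval, since the error attains its maximum. -/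
lemma exists_bound (F : IsResonanceFamily N x k₀ lam l κ k δ u D) (hu : ∀ s, Continuous (u s))
    {W : ℕ → ℝ} {c : ι → ℂ} (hc : ∀ j, 1 ≤ j → j ≤ 2 * N → IsOrder l κ 1 fun s =>
      gauge N x k₀ j * D s j - c s * slope N x 1 k₀ W (2 * (j / 2)))
    (hinv : IsOrder l κ 0 fun s => (c s)⁻¹) (hne : ∀ᶠ s in l, c s ≠ 0) (a : ℕ) {n : ℕ}
    (h1 : 1 ≤ n) (h2 : n ≤ 2 * N - 1) :
    ∃ K : ℝ, ∀ᶠ s in l, ∀ y ∈ Set.Icc (x n) (x (n + 1)),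
      ‖k₀ * gauge N x k₀ a / c s * u s y - leadingProfile N x k₀ W a n y‖ ≤ K * ‖κ s‖ := by
  have hle : x n ≤ x (n + 1) := by
    have := F.t_pos h1 (by omega)
    rw [t_one] at this
    linarith
  have hmax : ∀ s, ∃ y ∈ Set.Icc (x n) (x (n + 1)), IsMaxOn (fun y =>
      ‖k₀ * gauge N x k₀ a / c s * u s y - leadingProfile N x k₀ W a n y‖)
      (Set.Icc (x n) (x (n + 1))) y := by
    intro s
    refine isCompact_Icc.exists_isMaxOn (Set.nonempty_Icc.2 hle) (Continuous.continuousOn ?_)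
    have := hu s
    unfold leadingProfile
    split_ifs <;> fun_prop
  choose y hy hymax using hmax
  obtain ⟨K, hK⟩ := (F.isOrder_sub_leadingProfile hc hinv hne a h1 h2 hy).bound
  refine ⟨K, ?_⟩
  filter_upwards [hK] with s hs z hz
  rw [pow_one] at hs
  exact (hymax s hz).trans hs

end IsResonanceFamily

/-! ### Uniform estimates -/

/-- An eigenmode, with its parameters, whose largest outer derivative has modulus one and whose
wave number is `M * ‖δ‖`-close to `k₀ + κ`, where `κ` is a square root of `lam * δ`. -/
structure NormalizedMode (N : ℕ) (x : ℕ → ℝ) (k₀ lam M : ℝ) where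
  /-- The contrast. -/
  δ : ℂ
  /-- The square root of `lam * δ`. -/
  κ : ℂ
  /-- The wave number. -/
  k : ℂ
  /-- The mode. -/
  u : ℝ → ℂ
  /-- The outer derivatives of the mode. -/
  D : ℕ → ℂ
  δ_ne : δ ≠ 0
  k_ne : k ≠ 0
  sq_eq : κ ^ 2 = lam * δ
  norm_sub_le : ‖k - (k₀ + κ)‖ ≤ M * ‖δ‖
  continuous : Continuous u
  mode : HasOuterDerivs N x δ k u D
  norm_le : ∀ j, 1 ≤ j → j ≤ 2 * N → ‖D j‖ ≤ 1
  exists_norm_eq : ∃ j, 1 ≤ j ∧ j ≤ 2 * N ∧ ‖D j‖ = 1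

lemma norm_eq_sqrt_of_sq_eq {κ δ : ℂ} {lam : ℝ} (h : κ ^ 2 = lam * δ) :
    ‖κ‖ = √|lam| * √‖δ‖ := by
  have := congrArg norm h
  rw [norm_pow, norm_mul, Complex.norm_real, Real.norm_eq_abs] at this
  rw [← Real.sqrt_mul (abs_nonneg _), ← this, Real.sqrt_sq (norm_nonneg _)]

lemma NormalizedMode.isResonanceFamily {N : ℕ} {x : ℕ → ℝ} {k₀ lam : ℝ}
    (hx : StrictMonoOn x (Set.Icc 1 (2 * N))) (hk₀ : k₀ ≠ 0) (hlam : lam ≠ 0) (M : ℝ) :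
    IsResonanceFamily N x k₀ lam
      (comap (fun s : NormalizedMode N x k₀ lam M => ‖s.δ‖) (𝓝 0))
      NormalizedMode.κ NormalizedMode.k NormalizedMode.δ NormalizedMode.u NormalizedMode.D where
  strictMono := hx
  k₀_ne := hk₀
  lam_ne := hlam
  tendsto := by
    rw [tendsto_zero_iff_norm_tendsto_zero]
    simp_rw [fun s : NormalizedMode N x k₀ lam M => norm_eq_sqrt_of_sq_eq s.sq_eq]
    have h : Tendsto (fun r : ℝ => √|lam| * √r) (𝓝 0) (𝓝 0) := by
      have : Continuous fun r : ℝ => √|lam| * √r := by fun_prop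
      simpa using this.tendsto 0
    exact h.comp tendsto_comap
  κ_ne s h := by
    have := s.sq_eq
    rw [h, zero_pow two_ne_zero, eq_comm, mul_eq_zero] at this
    exact this.elim (by exact_mod_cast hlam) s.δ_ne
  k_ne s := s.k_ne
  isOrder := by
    refine Asymptotics.IsBigO.of_bound (M / |lam|) (Eventually.of_forall fun s => ?_)
    rw [s.sq_eq, norm_mul, Complex.norm_real, Real.norm_eq_abs, ← mul_assoc,
      div_mul_cancel₀ _ (abs_ne_zero.2 hlam)]
    exact s.norm_sub_le
  sq_eq s := s.sq_eq
  mode s := s.mode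
  norm_le s := s.norm_le

/-- Wave numbers close to `k₀ ≠ 0` do not vanish. -/
lemma exists_forall_ne_zero {k₀ : ℝ} (hk₀ : k₀ ≠ 0) (lam M : ℝ) :
    ∃ ε > 0, ∀ δ κ k : ℂ, ‖δ‖ < ε → κ ^ 2 = lam * δ → ‖k - (k₀ + κ)‖ ≤ M * ‖δ‖ → k ≠ 0 := by
  have hcont : Continuous fun r : ℝ => √|lam| * √r + M * r := by fun_prop
  have hlim : ∀ᶠ r in 𝓝 (0 : ℝ), √|lam| * √r + M * r < |k₀| :=
    (hcont.tendsto 0).eventually_lt_const (by simpa using hk₀)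
  obtain ⟨ε, hε, h⟩ := Metric.eventually_nhds_iff.1 hlim
  refine ⟨ε, hε, ?_⟩
  rintro δ κ k hδ hκ hk rfl
  have h1 := h (y := ‖δ‖) (by simpa using hδ)
  rw [← norm_eq_sqrt_of_sq_eq hκ] at h1
  rw [zero_sub, norm_neg] at hk
  have h2 := norm_sub_le ((k₀ : ℂ) + κ) κ
  rw [add_sub_cancel_right, Complex.norm_real, Real.norm_eq_abs] at h2
  linarith

/-- An eigenmode can be scaled so that its largest outer derivative has modulus one. -/
lemma IsEigenmode.exists_normalizedMode {N : ℕ} {x : ℕ → ℝ} {k₀ lam M : ℝ} {δ κ k : ℂ}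
    {u : ℝ → ℂ} (hx : StrictMonoOn x (Set.Icc 1 (2 * N))) (hN : 0 < N) (hδ : δ ≠ 0) (hk : k ≠ 0)
    (hκ : κ ^ 2 = lam * δ) (hkM : ‖k - (k₀ + κ)‖ ≤ M * ‖δ‖) (hu : IsEigenmode N x 1 δ k u) :
    ∃ c : ℂ, c ≠ 0 ∧ ∃ s : NormalizedMode N x k₀ lam M, s.δ = δ ∧ s.κ = κ ∧
      s.u = fun y => c * u y := by
  obtain ⟨D, hD⟩ := hu.exists_hasOuterDerivs hx hN
  obtain ⟨j, hj1, hj2, hj⟩ := hu.exists_outerDeriv_ne_zero hx hN hk hD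
  obtain ⟨m, hm, hmax⟩ := (Finset.Icc 1 (2 * N)).exists_max_image (fun j => ‖D j‖)
    ⟨1, Finset.mem_Icc.2 ⟨le_rfl, by omega⟩⟩
  obtain ⟨hm1, hm2⟩ := Finset.mem_Icc.1 hm
  have hpos : 0 < ‖D m‖ := (norm_pos_iff.2 hj).trans_le (hmax j (Finset.mem_Icc.2 ⟨hj1, hj2⟩))
  have hc : ((‖D m‖⁻¹ : ℝ) : ℂ) ≠ 0 := by exact_mod_cast (inv_pos.2 hpos).ne'
  have hnorm : ∀ j, ‖((‖D m‖⁻¹ : ℝ) : ℂ) * D j‖ = ‖D m‖⁻¹ * ‖D j‖ := fun j => by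
    rw [norm_mul, Complex.norm_real, Real.norm_of_nonneg (inv_pos.2 hpos).le]
  have hcont := hu.continuous
  refine ⟨_, hc, ⟨δ, κ, k, _, _, hδ, hk, hκ, hkM, by fun_prop, hD.const_mul _, fun j h1 h2 => ?_,
    m, hm1, hm2, ?_⟩, rfl, rfl, rfl⟩
  · rw [hnorm, inv_mul_le_iff₀ hpos, mul_one]
    exact hmax j (Finset.mem_Icc.2 ⟨h1, h2⟩)
  · rw [hnorm, inv_mul_cancel₀ hpos.ne']

/-- Uniform convergence of the normalized modes to their leading profile. -/
theorem exists_uniform_bound {N : ℕ} {x : ℕ → ℝ} {k₀ lam : ℝ}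
    (hx : StrictMonoOn x (Set.Icc 1 (2 * N))) (hN : 0 < N) (hk₀ : k₀ ≠ 0) (hlam : lam ≠ 0)
    {W : ℕ → ℝ} (hline : ∀ v : Fin N → ℝ, (capacitance N x 1 k₀).mulVec v = lam • v →
      ∃ c : ℝ, v = c • fun i : Fin N => W i) (a : ℕ) (M : ℝ) :
    ∃ δ₀ > 0, ∃ K : ℝ, ∀ δ κ k : ℂ, 0 < ‖δ‖ → ‖δ‖ < δ₀ → κ ^ 2 = lam * δ →
      ‖k - (k₀ + κ)‖ ≤ M * ‖δ‖ → ∀ u : ℝ → ℂ, IsEigenmode N x 1 δ k u →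
      ∃ c : ℂ, c ≠ 0 ∧ ∀ n, 1 ≤ n → n ≤ 2 * N - 1 → ∀ y ∈ Set.Icc (x n) (x (n + 1)),
        ‖c * u y - leadingProfile N x k₀ W a n y‖ ≤ K * ‖δ‖ ^ ((1 : ℝ) / 2) := by
  have F := NormalizedMode.isResonanceFamily hx hk₀ hlam M
  obtain ⟨c, hc⟩ := F.exists_isOrder_sub hline
  obtain ⟨hinv, hne⟩ := F.isOrder_coeff_inv NormalizedMode.exists_norm_eq hc
  choose! K hK using fun n (hn : n ∈ Finset.Icc 1 (2 * N - 1)) =>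
    F.exists_bound NormalizedMode.continuous hc hinv hne a (Finset.mem_Icc.1 hn).1
      (Finset.mem_Icc.1 hn).2
  have hall := hne.and ((Filter.eventually_all_finset _).2 hK)
  obtain ⟨ε, hε, hεall⟩ := (Metric.nhds_basis_ball.comap _).eventually_iff.1 hall
  obtain ⟨ε', hε', hkne⟩ := exists_forall_ne_zero hk₀ lam M
  refine ⟨min ε ε', lt_min hε hε', (∑ n ∈ Finset.Icc 1 (2 * N - 1), |K n|) * √|lam|, ?_⟩
  intro δ κ k hδ0 hδ hκ hk u hu
  obtain ⟨c', hc', s, hsδ, hsκ, hsu⟩ := hu.exists_normalizedMode hx hN (norm_pos_iff.1 hδ0)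
    (hkne δ κ k (hδ.trans_le (min_le_right _ _)) hκ hk) hκ hk
  obtain ⟨hcs, hbound⟩ := hεall (x := s) (by
    simpa [hsδ] using hδ.trans_le (min_le_left _ _))
  have hga : (gauge N x k₀ a : ℂ) ≠ 0 := by
    have := abs_gauge (N := N) (x := x) (k₀ := k₀) a
    have h0 : gauge N x k₀ a ≠ 0 := fun h => by rw [h] at this; norm_num at this
    exact_mod_cast h0
  refine ⟨k₀ * gauge N x k₀ a / c s * c',
    mul_ne_zero (div_ne_zero (mul_ne_zero (by exact_mod_cast hk₀) hga) hcs) hc', ?_⟩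
  intro n h1 h2 y hy
  have hn := Finset.mem_Icc.2 ⟨h1, h2⟩
  have := hbound n hn y hy
  rw [hsu, hsκ, norm_eq_sqrt_of_sq_eq hκ] at this
  rw [mul_assoc, ← Real.sqrt_eq_rpow, mul_assoc]
  refine this.trans (mul_le_mul_of_nonneg_right ?_ (by positivity))
  exact (le_abs_self _).trans
    (Finset.single_le_sum (f := fun n => |K n|) (fun _ _ => abs_nonneg _) hn)

/-- On the spacings of the target block the leading profile is a multiple of one and the same
sine. -/
lemma leadingProfile_eq {N : ℕ} {x : ℕ → ℝ} {k₀ : ℝ} {W : ℕ → ℝ} {a b n : ℕ}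
    (hab : IsResonantBlock N x 1 k₀ a b) (h1 : a ≤ n) (h2 : n ≤ b) (hn : n % 2 = 0) (y : ℝ) :
    leadingProfile N x k₀ W a n y = slope N x 1 k₀ W n * Real.sin (k₀ * (y - x a)) := by
  obtain ⟨e1, e2⟩ := hab.gauge_mul_gauge h1 (by omega : n ≤ b + 1)
  rw [leadingProfile, if_pos hn, e1,
    show k₀ * (y - x a) = k₀ * (y - x n) + k₀ * (x n - x a) by ring, Real.sin_add, e2]
  ring

/-- Away from the spacings of the target block the leading profile vanishes. -/
lemma leadingProfile_eq_zero {N : ℕ} {x : ℕ → ℝ} {k₀ : ℝ} {W : ℕ → ℝ} {a b n : ℕ}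
    (hab : IsResonantBlock N x 1 k₀ a b)
    (hW : ∀ i, ¬ (a ≤ 2 * i + 1 ∧ 2 * i + 1 ≤ b) → W i = 0) (h : ¬ (a ≤ n ∧ n ≤ b ∧ n % 2 = 0))
    (h1 : 1 ≤ n) (y : ℝ) : leadingProfile N x k₀ W a n y = 0 := by
  rw [leadingProfile]
  split_ifs with hn
  · have hslope : slope N x 1 k₀ W n = 0 := by
      by_cases hres : IsResonantIndex N x 1 k₀ n
      · -- A resonant index outside the block is not adjacent to the block either.
        have e1 : n ≠ a - 1 := fun e => hab.2.2.2.1 (e ▸ hres)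
        have e2 : n ≠ b + 1 := fun e => hab.2.2.2.2 (e ▸ hres)
        have e3 := hab.1
        rw [slope, hW _ (by omega), hW _ (by omega), sub_zero, mul_zero]
      · rw [slope, invT_eq_zero hres, zero_mul]
    rw [hslope, mul_zero, zero_mul]
  · rfl

end ResonatorChain

theorem theorem2p3 (N : ℕ) (x : ℕ → ℝ) (hx : StrictMonoOn x (Set.Icc 1 (2 * N)))
    (k₀ : ℝ) (hk₀ : k₀ ≠ 0) (lam : ℝ) (hlam : lam ≠ 0)
    (hsimple : (ResonatorChain.capacitance N x 1 k₀).charpoly.rootMultiplicity lam = 1) :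
    ∃ a b : ℕ,
      -- the target block: the only block of which `lam` is an eigenvalue
      ResonatorChain.IsResonantBlock N x 1 k₀ a b ∧
      (ResonatorChain.blockC N x 1 k₀ a b).charpoly.rootMultiplicity lam = 1 ∧
      (∀ a' b' : ℕ, ResonatorChain.IsResonantBlock N x 1 k₀ a' b' →
        (ResonatorChain.blockC N x 1 k₀ a' b').charpoly.IsRoot lam → a' = a ∧ b' = b) ∧
      ∃ β : Fin (ResonatorChain.numEven a b) → ℝ,
        Module.End.HasEigenvector (Matrix.toLin' (ResonatorChain.blockD x 1 a b)) lam β ∧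
      ∃ γ : ℕ → ℕ, (∀ i, 0 < γ i) ∧
      ∀ M : ℝ, ∃ δ₀ > 0, ∃ K : ℝ,
        -- `κ` is either of the two square roots of `lam * δ`
        ∀ δ κ k : ℂ, 0 < ‖δ‖ → ‖δ‖ < δ₀ → κ ^ 2 = lam * δ → ‖k - (k₀ + κ)‖ ≤ M * ‖δ‖ →
        ∀ u : ℝ → ℂ, ResonatorChain.IsEigenmode N x 1 δ k u →
        -- the normalization of the eigenmode
        ∃ c : ℂ, c ≠ 0 ∧
          (∀ j : Fin (ResonatorChain.numEven a b),
            ∀ y ∈ Set.Ioo (x (ResonatorChain.evenIndex a j))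
              (x (ResonatorChain.evenIndex a j + 1)),
              ‖c * u y - ((β j * Real.sin (k₀ * (y - x a)) : ℝ) : ℂ)‖
                ≤ K * ‖δ‖ ^ ((1 : ℝ) / 2)) ∧
          (∀ i : ℕ, 1 ≤ i → i ≤ 2 * N - 1 →
            (∀ j : Fin (ResonatorChain.numEven a b), i ≠ ResonatorChain.evenIndex a j) →
            ∀ y ∈ Set.Ioo (x i) (x (i + 1)),
              ‖c * u y‖ ≤ K * ‖δ‖ ^ ((γ i : ℝ) / 2)) := by
  obtain ⟨a, b, hab, hmult, huniq, W, hW0, hWs, hW, hline⟩ :=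
    ResonatorChain.exists_target_block hlam hsimple
  have hN : 0 < N := by
    have h := hab.2.2.1 a le_rfl hab.2.1
    have := h.1
    have := h.2.1
    omega
  have hmem : ∀ j : Fin (ResonatorChain.numEven a b), a ≤ ResonatorChain.evenIndex a j ∧
      ResonatorChain.evenIndex a j ≤ b ∧ ResonatorChain.evenIndex a j % 2 = 0 := by
    rintro ⟨j, hj⟩
    have := hab.1
    unfold ResonatorChain.numEven at hj
    simp only [ResonatorChain.evenIndex]
    omega
  refine ⟨a, b, hab, hmult, huniq, _, ResonatorChain.hasEigenvector_blockD (fun j hj =>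
    (ResonatorChain.t_one_pos hx hj.1 (by have := hj.1; have := hj.2.1; omega)).ne') hlam hab
    hW0 hWs hW, fun _ => 1, fun _ => one_pos, fun M => ?_⟩
  obtain ⟨δ₀, hδ₀, K, hK⟩ := ResonatorChain.exists_uniform_bound hx hN hk₀ hlam hline a M
  refine ⟨δ₀, hδ₀, K, fun δ κ k h1 h2 h3 h4 u hu => ?_⟩
  obtain ⟨c, hc, hbound⟩ := hK δ κ k h1 h2 h3 h4 u hu
  refine ⟨c, hc, fun j y hy => ?_, fun i hi1 hi2 hi y hy => ?_⟩
  · obtain ⟨e1, e2, e3⟩ := hmem j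
    have hres := hab.2.2.1 _ e1 e2
    have := hbound _ hres.1 hres.2.1 y (Set.Ioo_subset_Icc_self hy)
    rwa [ResonatorChain.leadingProfile_eq hab e1 e2 e3] at this
  · have := hbound i hi1 hi2 y (Set.Ioo_subset_Icc_self hy)
    rw [ResonatorChain.leadingProfile_eq_zero hab hWs _ hi1] at this
    · simpa using this
    · rintro ⟨e1, e2, e3⟩
      have := hab.1
      refine hi ⟨i / 2 - (a + 1) / 2, ?_⟩ ?_
      · unfold ResonatorChain.numEven
        omega
      · simp only [ResonatorChain.evenIndex]
        omega
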